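/- **Theorem 3.1.** Let $T$ be a hyperbolic automorphism of the torus $\mathbb T^2=\mathbb R^2/\mathbb Z^2$ given by a matrix $M=\begin{pmatrix}a&b\\c&d\end{pmatrix}\in GL(2,\mathbb Z)$ (no eigenvalue of $M$ has modulus $1$) with trace $r=a+d>0$ and determinant $\sigma=\pm1$. Put $D=r^2-4\sigma$, $\lambda=\frac{r+\sqrt D}{2}$ and $f_T(x,y)=bx^2-(a-d)xy-cy^2$. Let $\mathfrak X$ be the following set of two-sided sequences $\varepsilon=(\varepsilon_n)_{n\in\mathbb Z}$ of non-negative integers. If $\sigma=-1$: $\varepsilon_n\le r$ for all $n$, and $\varepsilon_n=r$ implies $\varepsilon_{n+1}=0$. If $\sigma=+1$: $\varepsilon_n\le r-1$ for all $n$, and no block $(r-1)(r-2)^j(r-1)$ with $j\ge0$ occurs. For $(u,v)\in\mathbb Z^2$ let $$\begin{pmatrix}n\\k\end{pmatrix}=-\sigma M\begin{pmatrix}v\\u\end{pmatrix},\qquad \mathbf t=\mathbf t(u,v)=\left(\frac{v+n\lambda}{\sqrt D},\frac{u+k\lambda}{\sqrt D}\right)\bmod\mathbb Z^2 .$$ Then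 $\mathbf t$ is homoclinic to zero, i.e. $T^m\mathbf t\to\mathbf 0$ as $m\to\pm\infty$; the limit $$\varphi_{\mathbf t}(\varepsilon)=\lim_{N\to\infty}\sum_{n=-N}^{N}\varepsilon_nT^{-n}\mathbf t$$ exists in $\mathbb T^2$ for every $\varepsilon\in\mathfrak X$; and the arithmetic coding $\varphi_{\mathbf t}:\mathfrak X\to\mathbb T^2$ is $K$-to-$1$ almost everywhere with $$K=K(u,v)=|f_T(u,-v)|,$$ i.e. for Lebesgue almost every $x\in\mathbb T^2$ there are exactly $K$ sequences $\varepsilon\in\mathfrak X$ with $\varphi_{\mathbf t}(\varepsilon)=x$. -/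

import Mathlib

open Filter Topology MeasureTheory

noncomputable section

namespace ToralCoding

/-- The two-dimensional torus `ℝ² / ℤ²`, written as `(ℝ / ℤ)²`. Its `volume` is the normalized
Lebesgue (Haar) measure. -/
abbrev Torus : Type := Fin 2 → UnitAddCircle

/-- Reduction of a point of the plane modulo `ℤ²`. -/
def toTorus (x : Fin 2 → ℝ) : Torus := fun i => (x i : UnitAddCircle)

/-- The endomorphism `x ↦ M x` of the torus given by an integral matrix `M`; it is an automorphism
for `M ∈ GL(2, ℤ)`. -/
def act (M : GL (Fin 2) ℤ) : Torus →+ Torus where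
  toFun x := fun i => ∑ j, M.val i j • x j
  map_zero' := by
    funext i
    simp
  map_add' x y := by
    funext i
    simp [smul_add, Finset.sum_add_distrib]

/-- The automorphism given by `M` is hyperbolic: no eigenvalue of `M` has modulus one. -/
def IsHyperbolic (M : GL (Fin 2) ℤ) : Prop :=
  ∀ z ∈ spectrum ℂ (M.val.map (Int.cast : ℤ → ℂ)), ‖z‖ ≠ 1

/-- The discriminant `D = r² - 4σ` of the characteristic polynomial `x² - r x + σ`. -/
def discrim (M : GL (Fin 2) ℤ) : ℤ := M.val.trace ^ 2 - 4 * M.val.det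

/-- The eigenvalue `(r + √D) / 2`. -/
def eigenvalue (M : GL (Fin 2) ℤ) : ℝ :=
  ((M.val.trace : ℝ) + Real.sqrt (discrim M : ℝ)) / 2

/-- The quadratic form `b x² - (a - d) x y - c y²` associated with the matrix `(a, b; c, d)`. -/
def assocForm (M : GL (Fin 2) ℤ) (x y : ℤ) : ℤ :=
  M.val 0 1 * x ^ 2 - (M.val 0 0 - M.val 1 1) * x * y - M.val 1 0 * y ^ 2

/-- A point of the torus is homoclinic (to zero) if `Tⁿ t → 0` as `n → ±∞`. -/
def IsHomoclinic (M : GL (Fin 2) ℤ) (t : Torus) : Prop :=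
  Tendsto (fun n : ℤ => act (M ^ n) t) atTop (𝓝 0) ∧
    Tendsto (fun n : ℤ => act (M ^ n) t) atBot (𝓝 0)

/-- The integral vector `(n, k) = - det M • M (v, u)`. -/
def latticeVector (M : GL (Fin 2) ℤ) (u v : ℤ) : Fin 2 → ℤ :=
  (-M.val.det) • M.val.mulVec ![v, u]

/-- The point of the torus with planar coordinates `((v + n λ) / √D, (u + k λ) / √D)`, where
`(n, k)` is the lattice vector above and `λ` is the eigenvalue above. -/
def homoclinicPoint (M : GL (Fin 2) ℤ) (u v : ℤ) : Torus :=
  toTorus ![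
    ((v : ℝ) + (latticeVector M u v 0 : ℝ) * eigenvalue M) / Real.sqrt (discrim M : ℝ),
    ((u : ℝ) + (latticeVector M u v 1 : ℝ) * eigenvalue M) / Real.sqrt (discrim M : ℝ)]

/-- The Markov compactum: digits `0, …, r`, and a digit `r` is followed by `0`. -/
def markovCompactum (r : ℤ) : Set (ℤ → ℕ) :=
  {e | (∀ n, (e n : ℤ) ≤ r) ∧ ∀ n, (e n : ℤ) = r → e (n + 1) = 0}

/-- The sofic compactum: digits `0, …, r - 1`, and no block of the form
`(r - 1) (r - 2) … (r - 2) (r - 1)`, with any number (possibly zero) of digits `r - 2` between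
the two digits `r - 1`. -/
def soficCompactum (r : ℤ) : Set (ℤ → ℕ) :=
  {e | (∀ n, (e n : ℤ) ≤ r - 1) ∧
    ∀ m n, m < n →
      ¬ ((e m : ℤ) = r - 1 ∧ (∀ i, m < i → i < n → (e i : ℤ) = r - 2) ∧ (e n : ℤ) = r - 1)}

/-- The symbolic compactum of `M`: the Markov one for `det M = -1`, the sofic one for
`det M = 1`. -/
def compactum (M : GL (Fin 2) ℤ) : Set (ℤ → ℕ) :=
  {e | (M.val.det = -1 → e ∈ markovCompactum M.val.trace) ∧
    (M.val.det = 1 → e ∈ soficCompactum M.val.trace)}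

/-- The symmetric partial sum from `-N` to `N` of the series of `e n • T⁻ⁿ t`. -/
def partialSum (M : GL (Fin 2) ℤ) (t : Torus) (e : ℤ → ℕ) (N : ℕ) : Torus :=
  ∑ n ∈ Finset.Icc (-(N : ℤ)) (N : ℤ), e n • act (M ^ (-n)) t

/-- The arithmetic coding with parameter `t`: the limit of the symmetric partial sums. -/
def coding (M : GL (Fin 2) ℤ) (t : Torus) (e : ℤ → ℕ) : Torus :=
  limUnder atTop (partialSum M t e)

end ToralCoding

end

/-!
Let `θ = (λ, λ')` be the pair of eigenvalues of `M`. The ring `ℤ[θ, θ⁻¹]` is a lattice in `ℝ × ℝ` on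
which `θ` acts as a saddle. A sequence `e` has a code point whose expanding coordinate is
`∑ e n λ⁻ⁿ` over `n ≥ 0` and whose contracting coordinate is `-∑ e n λ'⁻ⁿ` over `n < 0`; the shift
of `e` corresponds to `p ↦ θ (p - e 0)`. The code points of the admissible sequences lie in an
L-shaped region, which is a fundamental domain of the lattice up to its boundary and is mapped into
itself by the beta transformation `p ↦ θ (p - ⌊p₁⌋)`. Following the representatives of `θⁿ p` in
this domain shows that a generic `p` is congruent to exactly one code point.

The homoclinic point is the image of `(1, 0)`, equivalently of `(0, -1)`, under the homomorphism `ψ`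
from `ℝ × ℝ` to the torus which sends `x + y θ` to `x q + y M q`, where `q = (n, k)`. It intertwines
`θ` with `T`, so that the coding is `ψ` applied to the code point. Almost every point of the torus
therefore has as many codes as the index of `ℤ[θ, θ⁻¹]` in `ker ψ`, which is
`|det (q, M q)| = |f_T(u, -v)|`. If this determinant is zero, the image of `ψ` is a null set.
-/

open Bornology
open scoped NNReal

noncomputable section

namespace ToralCoding

/-! ### Contraction -/

theorem mem_of_mapsTo_of_contracting {ι E : Type*} [PseudoMetricSpace E] [ProperSpace E] {a : ℝ≥0}
    (ha : a < 1) {τ : ι → ι} {f : ι → E → E} (hf : ∀ i, LipschitzWith a (f i)) {x : ι → E}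
    (hx : IsBounded (Set.range x)) (hxf : ∀ i, x i = f i (x (τ i))) {K : ι → Set E}
    (hclosed : ∀ i, IsClosed (K i)) (hne : ∀ i, (K i).Nonempty) (hbdd : IsBounded (⋃ i, K i))
    (hmaps : ∀ i, Set.MapsTo (f i) (K (τ i)) (K i)) (i : ι) : x i ∈ K i := by
  have : Nonempty ι := ⟨i⟩
  set S := ⨆ i, Metric.infDist (x i) (K i)
  have hle : ∀ i, Metric.infDist (x i) (K i) ≤ S := by
    obtain ⟨C, hC⟩ := (Metric.isBounded_iff).1 (hx.union hbdd)
    refine le_ciSup (f := fun i => Metric.infDist (x i) (K i))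
      ⟨C, Set.forall_mem_range.2 fun i => ?_⟩
    obtain ⟨y, hy⟩ := hne i
    exact (Metric.infDist_le_dist_of_mem hy).trans
      (hC (Or.inl ⟨i, rfl⟩) (Or.inr (Set.mem_iUnion_of_mem i hy)))
  have hcontract : ∀ i, Metric.infDist (x i) (K i) ≤ a * S := fun i => by
    obtain ⟨y, hy, hdist⟩ := (hclosed (τ i)).exists_infDist_eq_dist (hne (τ i)) (x (τ i))
    calc Metric.infDist (x i) (K i) ≤ dist (f i (x (τ i))) (f i y) := by
          rw [← hxf]
          exact Metric.infDist_le_dist_of_mem (hmaps i hy)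
      _ ≤ a * dist (x (τ i)) y := (hf i).dist_le_mul _ _
      _ ≤ a * S := by
          rw [← hdist]
          exact mul_le_mul_of_nonneg_left (hle _) a.2
  have hS0 : S ≤ 0 := by
    have hSa : S ≤ a * S := ciSup_le hcontract
    nlinarith [NNReal.coe_lt_one.2 ha]
  exact ((hclosed i).mem_iff_infDist_zero (hne i)).2
    (((hle i).trans hS0).antisymm Metric.infDist_nonneg)

/-! ### Two-sided digit series -/

/-- The value `e n + e (n + 1) / l + e (n + 2) / l² + ⋯` of the digits from time `n` on. -/
def future (l : ℝ) (e : ℤ → ℕ) (n : ℤ) : ℝ := ∑' k : ℕ, (e (n + k) : ℝ) * l⁻¹ ^ k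

/-- The value `-(e (n - 1) m + e (n - 2) m² + ⋯)` of the digits before time `n`. -/
def past (m : ℝ) (e : ℤ → ℕ) (n : ℤ) : ℝ := -∑' k : ℕ, (e (n - (k + 1)) : ℝ) * m ^ (k + 1)

/-- The point of the plane with the digits `e`, seen from time `n`: the digits to come give the
expanding coordinate and the earlier ones the contracting coordinate. -/
def codePoint (θ : ℝ × ℝ) (e : ℤ → ℕ) (n : ℤ) : ℝ × ℝ := (future θ.1 e n, past θ.2 e n)

section Series

variable {l m : ℝ} {e : ℤ → ℕ} {B : ℕ}

theorem summable_digits {a : ℝ} (ha : |a| < 1) {f : ℕ → ℕ} (hf : ∀ k, f k ≤ B) :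
    Summable fun k => (f k : ℝ) * a ^ k := by
  refine Summable.of_norm_bounded (g := fun k => (B : ℝ) * |a| ^ k)
    ((summable_geometric_of_lt_one (abs_nonneg a) ha).mul_left _) fun k => ?_
  rw [norm_mul, norm_pow, Real.norm_eq_abs, Real.norm_eq_abs, Nat.abs_cast]
  gcongr
  exact hf k

theorem abs_tsum_digits_le {a : ℝ} (ha : |a| < 1) {f : ℕ → ℕ} (hf : ∀ k, f k ≤ B) :
    |∑' k, (f k : ℝ) * a ^ k| ≤ B * (1 - |a|)⁻¹ := by
  rw [← Real.norm_eq_abs]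
  refine tsum_of_norm_bounded (g := fun k => (B : ℝ) * |a| ^ k)
    ((hasSum_geometric_of_lt_one (abs_nonneg a) ha).mul_left _) fun k => ?_
  rw [norm_mul, norm_pow, Real.norm_eq_abs, Real.norm_eq_abs, Nat.abs_cast]
  gcongr
  exact hf k

theorem abs_inv_lt_one (hl : 1 < l) : |l⁻¹| < 1 := by
  rw [abs_inv]
  exact inv_lt_one_of_one_lt₀ (hl.trans_le (le_abs_self l))

theorem hasSum_future (hl : 1 < l) (he : ∀ n, e n ≤ B) (n : ℤ) :
    HasSum (fun k : ℕ => (e (n + k) : ℝ) * l⁻¹ ^ k) (future l e n) :=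
  (summable_digits (abs_inv_lt_one hl) fun _ => he _).hasSum

theorem past_eq_mul_tsum (n : ℤ) :
    past m e n = -(m * ∑' k : ℕ, (e (n - (k + 1)) : ℝ) * m ^ k) := by
  rw [past, ← tsum_mul_left]
  exact congrArg Neg.neg (tsum_congr fun k => by ring)

theorem hasSum_past (hm : |m| < 1) (he : ∀ n, e n ≤ B) (n : ℤ) :
    HasSum (fun k : ℕ => -((e (n - (k + 1)) : ℝ) * m ^ (k + 1))) (past m e n) := by
  refine (Summable.hasSum ?_).neg
  refine ((summable_digits hm (f := fun k : ℕ => e (n - (k + 1))) fun _ => he _).mul_left m).congr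
    fun k => ?_
  ring

theorem future_eq_digit_add (hl : 1 < l) (he : ∀ n, e n ≤ B) (n : ℤ) :
    future l e n = e n + l⁻¹ * future l e (n + 1) := by
  rw [future, (hasSum_future hl he n).summable.tsum_eq_zero_add, future, ← tsum_mul_left]
  congr 1
  · simp
  · refine tsum_congr fun k => ?_
    rw [show n + ((k + 1 : ℕ) : ℤ) = n + 1 + k by push_cast; ring]
    ring

theorem past_succ (hm : |m| < 1) (he : ∀ n, e n ≤ B) (n : ℤ) :
    past m e (n + 1) = m * (past m e n - e n) := by
  have hsum : Summable fun k : ℕ => (e (n + 1 - (k + 1)) : ℝ) * m ^ k :=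
    summable_digits hm fun _ => he _
  rw [past_eq_mul_tsum, hsum.tsum_eq_zero_add, past]
  simp only [Nat.cast_zero, zero_add, pow_zero, mul_one, add_sub_cancel_right, Nat.cast_add,
    Nat.cast_one, add_sub_add_right_eq_sub]
  ring

theorem isBounded_range_future (hl : 1 < l) (he : ∀ n, e n ≤ B) :
    IsBounded (Set.range (future l e)) :=
  isBounded_iff_forall_norm_le.2 ⟨B * (1 - |l⁻¹|)⁻¹, Set.forall_mem_range.2 fun _ =>
    abs_tsum_digits_le (abs_inv_lt_one hl) fun _ => he _⟩

theorem isBounded_range_past (hm : |m| < 1) (he : ∀ n, e n ≤ B) :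
    IsBounded (Set.range (past m e)) := by
  refine isBounded_iff_forall_norm_le.2 ⟨B * (1 - |m|)⁻¹, Set.forall_mem_range.2 fun n => ?_⟩
  rw [past_eq_mul_tsum, norm_neg, norm_mul]
  exact (mul_le_of_le_one_left (norm_nonneg _) hm.le).trans (abs_tsum_digits_le hm fun _ => he _)

theorem future_mem_of_forall_mapsTo (hl : 1 < l) (he : ∀ n, e n ≤ B) {K : ℤ → Set ℝ}
    (hclosed : ∀ n, IsClosed (K n)) (hne : ∀ n, (K n).Nonempty) (hbdd : IsBounded (⋃ n, K n))
    (h : ∀ n, Set.MapsTo (fun x => e n + l⁻¹ * x) (K (n + 1)) (K n)) (n : ℤ) :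
    future l e n ∈ K n := by
  refine mem_of_mapsTo_of_contracting (a := ‖l⁻¹‖₊) (abs_inv_lt_one hl) (τ := (· + 1))
    (fun n => LipschitzWith.of_dist_le_mul fun x y => ?_) (isBounded_range_future hl he)
    (future_eq_digit_add hl he) hclosed hne hbdd h n
  simp [Real.dist_eq, ← mul_sub, abs_mul]

theorem past_mem_of_forall_mapsTo (hm : |m| < 1) (he : ∀ n, e n ≤ B) {K : ℤ → Set ℝ}
    (hclosed : ∀ n, IsClosed (K n)) (hne : ∀ n, (K n).Nonempty) (hbdd : IsBounded (⋃ n, K n))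
    (h : ∀ n, Set.MapsTo (fun y => m * (y - e n)) (K n) (K (n + 1))) (n : ℤ) :
    past m e n ∈ K n := by
  refine mem_of_mapsTo_of_contracting (a := ‖m‖₊) hm (τ := (· - 1))
    (f := fun n y => m * (y - e (n - 1)))
    (fun n => LipschitzWith.of_dist_le_mul fun x y => ?_) (isBounded_range_past hm he)
    (fun n => ?_) hclosed hne hbdd (fun n => ?_) n
  · simp [Real.dist_eq, ← mul_sub, abs_mul]
  · rw [← past_succ hm he, sub_add_cancel]
  · simpa using h (n - 1)

end Series

/-! ### The ring of a unit -/

/-- `θ = (θ₁, θ₂)` acts on the plane `ℝ × ℝ` by multiplication as a saddle: it expands the first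
coordinate, preserving its sign, and contracts the second one. -/
structure IsSaddle (θ : ℝ × ℝ) : Prop where
  one_lt_fst : 1 < θ.1
  abs_snd_lt_one : |θ.2| < 1
  snd_ne_zero : θ.2 ≠ 0

/-- The ring `ℤ[θ, θ⁻¹]` in `ℝ × ℝ`. For a quadratic unit and its conjugate it is a lattice. -/
def unitRing (θ : ℝ × ℝ) : Subring (ℝ × ℝ) := Subring.closure {θ, θ⁻¹}

/-- The coordinates of `p` are not coordinates of elements of `ℤ[θ, θ⁻¹]`. -/
def IsGeneric (θ p : ℝ × ℝ) : Prop := ∀ v ∈ unitRing θ, p.1 ≠ v.1 ∧ p.2 ≠ v.2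

/-- The map `p ↦ θ (p - d)` which removes the leading digit `d`, the integer part of the expanding
coordinate; the digit is a natural number, so it is `0` if that coordinate is negative. -/
def betaMap (θ p : ℝ × ℝ) : ℝ × ℝ := θ * (p - (⌊p.1⌋₊ : ℝ × ℝ))

section UnitRing

variable {θ p p' v : ℝ × ℝ}

theorem IsSaddle.isUnit (hθ : IsSaddle θ) : IsUnit θ :=
  Prod.isUnit_iff.2 ⟨isUnit_iff_ne_zero.2 (zero_lt_one.trans hθ.one_lt_fst).ne',
    isUnit_iff_ne_zero.2 hθ.snd_ne_zero⟩

theorem self_mem_unitRing : θ ∈ unitRing θ := Subring.subset_closure (Set.mem_insert _ _)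

theorem inv_mem_unitRing : θ⁻¹ ∈ unitRing θ :=
  Subring.subset_closure (Set.mem_insert_of_mem _ rfl)

theorem zpow_mem_unitRing (n : ℤ) : θ ^ n ∈ unitRing θ := by
  cases n with
  | ofNat k => simpa using pow_mem self_mem_unitRing k
  | negSucc k => simpa using pow_mem inv_mem_unitRing (k + 1)

theorem mul_mem_unitRing_iff (hθ : IsUnit θ) : θ * v ∈ unitRing θ ↔ v ∈ unitRing θ := by
  refine ⟨fun h => ?_, mul_mem self_mem_unitRing⟩
  simpa [← mul_assoc, hθ.inv_mul_cancel] using mul_mem inv_mem_unitRing h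

theorem zpow_succ_eq_mul (hθ : IsUnit θ) (n : ℤ) : θ ^ (n + 1) = θ * θ ^ n := by
  obtain ⟨u, rfl⟩ := hθ
  rw [← Units.val_zpow_eq_zpow_val, ← Units.val_zpow_eq_zpow_val, zpow_add_one, Units.val_mul,
    mul_comm]

theorem zpow_neg_mul_zpow_mul (hθ : IsUnit θ) (n : ℤ) (p : ℝ × ℝ) :
    θ ^ (-n) * (θ ^ n * p) = p := by
  obtain ⟨u, rfl⟩ := hθ
  rw [← Units.val_zpow_eq_zpow_val, ← Units.val_zpow_eq_zpow_val, zpow_neg,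
    Units.inv_mul_cancel_left]

theorem IsGeneric.of_sub_mem (hp : IsGeneric θ p) (h : p' - p ∈ unitRing θ) : IsGeneric θ p' := by
  intro v hv
  have := hp _ (sub_mem hv h)
  simpa [sub_sub_eq_add_sub, eq_sub_iff_add_eq, add_comm] using this

theorem IsGeneric.zpow_mul (hθ : IsUnit θ) (hp : IsGeneric θ p) (n : ℤ) :
    IsGeneric θ (θ ^ n * p) := by
  intro v hv
  have hne := hp _ (mul_mem (zpow_mem_unitRing (-n)) hv)
  have hp_eq := Prod.ext_iff.1 (zpow_neg_mul_zpow_mul hθ n p)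
  exact ⟨fun h => hne.1 (by rw [← hp_eq.1, Prod.fst_mul, h, Prod.fst_mul]),
    fun h => hne.2 (by rw [← hp_eq.2, Prod.snd_mul, h, Prod.snd_mul])⟩

end UnitRing

section CodePoint

variable {θ p : ℝ × ℝ} {e : ℤ → ℕ} {B : ℕ}

theorem codePoint_succ (hθ : IsSaddle θ) (he : ∀ n, e n ≤ B) (n : ℤ) :
    codePoint θ e (n + 1) = θ * (codePoint θ e n - (e n : ℝ × ℝ)) := by
  have hne : θ.1 ≠ 0 := (zero_lt_one.trans hθ.one_lt_fst).ne'
  ext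
  · simp [codePoint, future_eq_digit_add hθ.one_lt_fst he n, hne]
  · simp [codePoint, past_succ hθ.abs_snd_lt_one he]

theorem codePoint_eq_of_isBounded (hθ : IsSaddle θ) (he : ∀ n, e n ≤ B) {x : ℤ → ℝ × ℝ}
    (hx : IsBounded (Set.range x)) (hxe : ∀ n, x (n + 1) = θ * (x n - (e n : ℝ × ℝ))) :
    codePoint θ e = x := by
  have hne : θ.1 ≠ 0 := (zero_lt_one.trans hθ.one_lt_fst).ne'
  funext n
  refine Prod.ext ?_ ?_
  · refine future_mem_of_forall_mapsTo hθ.one_lt_fst he (K := fun n => {(x n).1})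
      (fun _ => isClosed_singleton) (fun _ => Set.singleton_nonempty _) ?_ (fun n => ?_) n
    · rw [Set.iUnion_singleton_eq_range]
      exact Set.range_comp Prod.fst x ▸ hx.image_fst
    · simp [hxe, hne]
  · refine past_mem_of_forall_mapsTo hθ.abs_snd_lt_one he (K := fun n => {(x n).2})
      (fun _ => isClosed_singleton) (fun _ => Set.singleton_nonempty _) ?_ (fun n => ?_) n
    · rw [Set.iUnion_singleton_eq_range]
      exact Set.range_comp Prod.snd x ▸ hx.image_snd
    · simp [hxe]

end CodePoint

/-! ### Coding by a fundamental domain -/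

/-- `R` contains a representative of every class of `ℝ × ℝ` modulo `ℤ[θ, θ⁻¹]`, which is unique
for generic classes, and `X` is the symbolic system of the digits of the map `betaMap θ` on `R`. -/
structure IsCodingTile (θ : ℝ × ℝ) (R : Set (ℝ × ℝ)) (X : Set (ℤ → ℕ)) : Prop where
  isBounded : IsBounded R
  exists_sub_mem : ∀ p, ∃ p' ∈ R, p' - p ∈ unitRing θ
  eq_of_sub_mem : ∀ p ∈ R, IsGeneric θ p → ∀ p' ∈ R, p' - p ∈ unitRing θ → p' = p
  exists_digit_le : ∃ B : ℕ, ∀ e ∈ X, ∀ n, e n ≤ B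
  codePoint_mem : ∀ e ∈ X, ∀ n, codePoint θ e n ∈ R
  mapsTo_betaMap : Set.MapsTo (betaMap θ) R R
  floor_mem : ∀ x : ℤ → ℝ × ℝ, (∀ n, x n ∈ R) → (∀ n, IsGeneric θ (x n)) →
    (∀ n, x (n + 1) = betaMap θ (x n)) → (fun n => ⌊(x n).1⌋₊) ∈ X

section Tile

variable {θ p : ℝ × ℝ} {R : Set (ℝ × ℝ)} {X : Set (ℤ → ℕ)} {e : ℤ → ℕ}

theorem sub_zpow_mul_mem (hθ : IsUnit θ) {x : ℤ → ℝ × ℝ}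
    (hx : ∀ n, x (n + 1) = θ * (x n - (e n : ℝ × ℝ))) (h0 : x 0 - p ∈ unitRing θ) (n : ℤ) :
    x n - θ ^ n * p ∈ unitRing θ := by
  have hstep : ∀ n, x (n + 1) - θ ^ (n + 1) * p ∈ unitRing θ ↔ x n - θ ^ n * p ∈ unitRing θ := by
    intro n
    have heq : x (n + 1) - θ ^ (n + 1) * p = θ * (x n - θ ^ n * p - (e n : ℝ × ℝ)) := by
      rw [hx, zpow_succ_eq_mul hθ]
      ring
    rw [heq, mul_mem_unitRing_iff hθ]
    rw [sub_eq_add_neg, add_mem_cancel_right (neg_mem (natCast_mem _ _))]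
  induction n with
  | zero => simpa using h0
  | succ k ih => exact (hstep k).2 ih
  | pred k ih => exact (hstep (-k - 1)).1 (by simpa using ih)

namespace IsCodingTile

theorem exists_code (hR : IsCodingTile θ R X) (hθ : IsSaddle θ) (hp : IsGeneric θ p) :
    ∃ e ∈ X, codePoint θ e 0 - p ∈ unitRing θ := by
  choose x hxR hxp using fun n : ℤ => hR.exists_sub_mem (θ ^ n * p)
  have hgen : ∀ n, IsGeneric θ (x n) := fun n => (hp.zpow_mul hθ.isUnit n).of_sub_mem (hxp n)
  have hstep : ∀ n, x (n + 1) = betaMap θ (x n) := fun n => by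
    refine (hR.eq_of_sub_mem _ (hxR _) (hgen _) _ (hR.mapsTo_betaMap (hxR n)) ?_).symm
    have hshift : betaMap θ (x n) - θ ^ (n + 1) * p ∈ unitRing θ := by
      have heq : betaMap θ (x n) - θ ^ (n + 1) * p =
          θ * (x n - θ ^ n * p - (⌊(x n).1⌋₊ : ℝ × ℝ)) := by
        rw [betaMap, zpow_succ_eq_mul hθ.isUnit]
        ring
      rw [heq, mul_mem_unitRing_iff hθ.isUnit]
      exact sub_mem (hxp n) (natCast_mem _ _)
    simpa using sub_mem hshift (hxp (n + 1))
  have heX := hR.floor_mem x hxR hgen hstep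
  obtain ⟨B, hB⟩ := hR.exists_digit_le
  have heq := codePoint_eq_of_isBounded hθ (hB _ heX)
    (hR.isBounded.subset (Set.range_subset_iff.2 hxR)) hstep
  refine ⟨_, heX, ?_⟩
  simpa [heq] using hxp 0

theorem code_unique (hR : IsCodingTile θ R X) (hθ : IsSaddle θ) (hp : IsGeneric θ p)
    {e' : ℤ → ℕ} (he : e ∈ X) (he' : e' ∈ X) (hep : codePoint θ e 0 - p ∈ unitRing θ)
    (hep' : codePoint θ e' 0 - p ∈ unitRing θ) : e = e' := by
  obtain ⟨B, hB⟩ := hR.exists_digit_le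
  have hstep := codePoint_succ hθ (hB e he)
  have hstep' := codePoint_succ hθ (hB e' he')
  have heq : ∀ n, codePoint θ e n = codePoint θ e' n := fun n => by
    have hmem := sub_zpow_mul_mem hθ.isUnit hstep hep n
    have hmem' := sub_zpow_mul_mem hθ.isUnit hstep' hep' n
    refine hR.eq_of_sub_mem _ (hR.codePoint_mem _ he' n)
      ((hp.zpow_mul hθ.isUnit n).of_sub_mem hmem') _ (hR.codePoint_mem _ he n) ?_
    simpa using sub_mem hmem hmem'
  funext n
  have hdigit : θ * (codePoint θ e n - (e n : ℝ × ℝ)) = θ * (codePoint θ e n - (e' n : ℝ × ℝ)) := by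
    rw [← hstep, heq, hstep', heq]
  simpa using hθ.isUnit.mul_left_cancel hdigit

theorem existsUnique_code (hR : IsCodingTile θ R X) (hθ : IsSaddle θ) (hp : IsGeneric θ p) :
    ∃! e, e ∈ X ∧ codePoint θ e 0 - p ∈ unitRing θ := by
  obtain ⟨e, he, hep⟩ := hR.exists_code hθ hp
  exact ⟨e, ⟨he, hep⟩, fun e' he' => hR.code_unique hθ hp he'.1 he he'.2 hep⟩

end IsCodingTile

end Tile

/-! ### Quadratic units and the tower tile -/

/-- `θ` consists of the two roots of `x² - r x + s`, where `s = ±1`, and is a saddle. -/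
structure IsQuadraticUnit (r s : ℤ) (θ : ℝ × ℝ) : Prop extends IsSaddle θ where
  sq_norm : s * s = 1
  add_eq : θ.1 + θ.2 = r
  mul_eq : θ.1 * θ.2 = s

/-- The union of a box of width `1` and height `1 - θ₂` and of a box of width `θ₁ - 1` and height
`1`, side by side. Here `1 - θ₂` and `1` are the return times of the exchange of the intervals
`[0, 1]` and `[1, θ₁]` by translations in `ℤ[θ, θ⁻¹]`. -/
def towerTile (θ : ℝ × ℝ) : Set (ℝ × ℝ) :=
  Set.Icc 0 1 ×ˢ Set.Icc θ.2 1 ∪ Set.Icc 1 θ.1 ×ˢ Set.Icc θ.2 (1 + θ.2)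

section QuadraticUnit

variable {r s : ℤ} {θ p p' v : ℝ × ℝ}

theorem IsQuadraticUnit.mul_self (hθ : IsQuadraticUnit r s θ) :
    θ * θ = (r : ℝ × ℝ) * θ - (s : ℝ × ℝ) := by
  ext
  · simp only [Prod.fst_mul, Prod.fst_sub, Prod.fst_intCast]
    linear_combination θ.1 * hθ.add_eq - hθ.mul_eq
  · simp only [Prod.snd_mul, Prod.snd_sub, Prod.snd_intCast]
    linear_combination θ.2 * hθ.add_eq - hθ.mul_eq

theorem IsQuadraticUnit.inv_eq (hθ : IsQuadraticUnit r s θ) : θ⁻¹ = (s : ℝ × ℝ) * (r - θ) := by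
  have hs : (s : ℝ × ℝ) * s = 1 := by exact_mod_cast congrArg (Int.cast : ℤ → ℝ × ℝ) hθ.sq_norm
  refine (eq_inv_of_mul_eq_one_left ?_).symm
  linear_combination hs - s * hθ.mul_self

theorem mem_unitRing_iff (hθ : IsQuadraticUnit r s θ) :
    v ∈ unitRing θ ↔ ∃ i j : ℤ, v = i + j * θ := by
  refine ⟨fun hv => ?_, ?_⟩
  · induction hv using Subring.closure_induction with
    | mem v hv =>
      rcases hv with rfl | rfl
      · exact ⟨0, 1, by simp⟩
      · exact ⟨s * r, -s, by rw [hθ.inv_eq]; push_cast; ring⟩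
    | zero => exact ⟨0, 0, by simp⟩
    | one => exact ⟨1, 0, by simp⟩
    | add v w _ _ hv hw =>
      obtain ⟨i, j, rfl⟩ := hv
      obtain ⟨k, l, rfl⟩ := hw
      exact ⟨i + k, j + l, by push_cast; ring⟩
    | neg v _ hv =>
      obtain ⟨i, j, rfl⟩ := hv
      exact ⟨-i, -j, by push_cast; ring⟩
    | mul v w _ _ hv hw =>
      obtain ⟨i, j, rfl⟩ := hv
      obtain ⟨k, l, rfl⟩ := hw
      refine ⟨i * k - j * l * s, i * l + j * k + j * l * r, ?_⟩
      push_cast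
      linear_combination (j * l : ℝ × ℝ) * hθ.mul_self
  · rintro ⟨i, j, rfl⟩
    exact add_mem (intCast_mem _ i) (mul_mem (intCast_mem _ j) self_mem_unitRing)

theorem IsGeneric.const_sub (hp : IsGeneric θ p) (hv : v ∈ unitRing θ) : IsGeneric θ (v - p) := by
  intro w hw
  have := hp _ (sub_mem hv hw)
  constructor
  · rintro h
    exact this.1 (by simp [← h])
  · rintro h
    exact this.2 (by simp [← h])

theorem exists_sub_mem_strip (h₁ : 1 < θ.1) (h₂ : θ.2 ≤ 1) (p : ℝ × ℝ) (y : ℝ) :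
    ∃ p', p' - p ∈ unitRing θ ∧ p'.1 ∈ Set.Ico 0 θ.1 ∧ y < p'.2 := by
  have hθ0 : 0 < θ.1 := by linarith
  have hinv : θ.1⁻¹ < 1 := inv_lt_one_of_one_lt₀ h₁
  -- Move `p` far along the diagonal, then back into the strip by a multiple of `θ`.
  obtain ⟨N, hN⟩ := exists_nat_gt (max (-p.1) ((y - p.2 + p.1 * θ.1⁻¹) / (1 - θ.1⁻¹)))
  obtain ⟨hN1, hN2⟩ := max_lt_iff.1 hN
  rw [div_lt_iff₀ (by linarith)] at hN2
  have hquot : 0 ≤ (p.1 + N) / θ.1 := div_nonneg (by linarith) hθ0.le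
  have hq : (0 : ℝ) ≤ ⌊(p.1 + N) / θ.1⌋ := by exact_mod_cast Int.floor_nonneg.2 hquot
  have hfloor := Int.floor_le ((p.1 + N) / θ.1)
  have hlt := Int.lt_floor_add_one ((p.1 + N) / θ.1)
  set q := ⌊(p.1 + N) / θ.1⌋
  have hmem : p + ((N : ℝ × ℝ) - q * θ) - p ∈ unitRing θ := by
    rw [add_sub_cancel_left]
    exact sub_mem (natCast_mem _ N) (mul_mem (intCast_mem _ q) self_mem_unitRing)
  refine ⟨p + (N - q * θ), hmem, ⟨?_, ?_⟩, ?_⟩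
  all_goals simp only [Prod.fst_add, Prod.fst_sub, Prod.fst_mul, Prod.fst_natCast,
    Prod.fst_intCast, Prod.snd_add, Prod.snd_sub, Prod.snd_mul, Prod.snd_natCast, Prod.snd_intCast]
  · rw [le_div_iff₀ hθ0] at hfloor
    linarith
  · rw [div_lt_iff₀ hθ0] at hlt
    linarith
  · rw [div_eq_mul_inv] at hfloor
    nlinarith

theorem exists_sub_mem_towerTile (h₁ : 1 < θ.1) (h₂ : θ.2 < 1) (p : ℝ × ℝ) :
    ∃ p' ∈ towerTile θ, p' - p ∈ unitRing θ := by
  -- An almost lowest translate in the strip lies in the tower, as otherwise it could be lowered by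
  -- a return translation, `θ - 1` over `[0, 1)` and `-1` over `[1, θ₁)`.
  set heights : Set ℝ :=
    {y | ∃ p', p' - p ∈ unitRing θ ∧ p'.1 ∈ Set.Ico 0 θ.1 ∧ θ.2 < p'.2 ∧ p'.2 = y}
  have hbdd : BddBelow heights := ⟨θ.2, by rintro _ ⟨q, -, -, hq, rfl⟩; exact hq.le⟩
  obtain ⟨q₀, hq₀, hq₀x, hq₀y⟩ := exists_sub_mem_strip h₁ h₂.le p θ.2
  have hstep : 0 < min 1 (1 - θ.2) := lt_min one_pos (by linarith)
  obtain ⟨_, ⟨q, hqp, hqx, hqy, rfl⟩, hlt⟩ :=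
    exists_lt_of_csInf_lt (s := heights) ⟨q₀.2, q₀, hq₀, hq₀x, hq₀y, rfl⟩
      (lt_add_of_pos_right (sInf heights) hstep)
  have hlow : ∀ v ∈ unitRing θ, (q + v).1 ∈ Set.Ico 0 θ.1 → v.2 ≤ -min 1 (1 - θ.2) →
      (q + v).2 ≤ θ.2 := by
    intro v hv hx hvy
    by_contra! hy
    have := csInf_le hbdd ⟨q + v, by simpa [add_sub_right_comm] using add_mem hqp hv, hx, hy, rfl⟩
    rw [Prod.snd_add] at this
    linarith
  refine ⟨q, ?_, hqp⟩
  rcases lt_or_ge q.1 1 with hq1 | hq1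
  · have hy := hlow (θ - 1) (sub_mem self_mem_unitRing (one_mem _))
    simp only [Prod.fst_add, Prod.fst_sub, Prod.fst_one, Prod.snd_add, Prod.snd_sub,
      Prod.snd_one] at hy
    have := hy ⟨by linarith [hqx.1], by linarith⟩ (by linarith [min_le_right 1 (1 - θ.2)])
    exact Or.inl ⟨⟨hqx.1, hq1.le⟩, ⟨hqy.le, by linarith⟩⟩
  · have hy := hlow (-1) (neg_mem (one_mem _))
    simp only [Prod.fst_add, Prod.fst_neg, Prod.fst_one, Prod.snd_add, Prod.snd_neg,
      Prod.snd_one] at hy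
    have := hy ⟨by linarith, by linarith [hqx.2]⟩ (by linarith [min_le_left 1 (1 - θ.2)])
    exact Or.inr ⟨⟨hq1, hqx.2.le⟩, ⟨hqy.le, by linarith⟩⟩

end QuadraticUnit

/-- The interiors of the two boxes of `towerTile θ`. -/
def openTower (θ : ℝ × ℝ) : Set (ℝ × ℝ) :=
  Set.Ioo 0 1 ×ˢ Set.Ioo θ.2 1 ∪ Set.Ioo 1 θ.1 ×ˢ Set.Ioo θ.2 (1 + θ.2)

section Uniqueness

variable {r s : ℤ} {θ p p' : ℝ × ℝ}

theorem IsGeneric.mem_Ioo_prod {v₁ w₁ v₂ w₂ : ℝ × ℝ} (hp : IsGeneric θ p)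
    (hv₁ : v₁ ∈ unitRing θ) (hw₁ : w₁ ∈ unitRing θ) (hv₂ : v₂ ∈ unitRing θ)
    (hw₂ : w₂ ∈ unitRing θ) (h : p ∈ Set.Icc v₁.1 w₁.1 ×ˢ Set.Icc v₂.2 w₂.2) :
    p ∈ Set.Ioo v₁.1 w₁.1 ×ˢ Set.Ioo v₂.2 w₂.2 :=
  ⟨⟨h.1.1.lt_of_ne' (hp v₁ hv₁).1, h.1.2.lt_of_ne (hp w₁ hw₁).1⟩,
    ⟨h.2.1.lt_of_ne' (hp v₂ hv₂).2, h.2.2.lt_of_ne (hp w₂ hw₂).2⟩⟩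

theorem IsGeneric.mem_openTower (hp : IsGeneric θ p) (h : p ∈ towerTile θ) : p ∈ openTower θ :=
  h.imp
    (hp.mem_Ioo_prod (v₁ := 0) (w₂ := 1) (zero_mem _) (one_mem _) self_mem_unitRing (one_mem _))
    (hp.mem_Ioo_prod (v₁ := 1) (w₂ := 1 + θ) (one_mem _) self_mem_unitRing self_mem_unitRing
      (add_mem (one_mem _) self_mem_unitRing))

theorem notMem_openTower_of_pos (h₁ : 1 < θ.1) (h₂ : 2 * θ.2 ≤ 1) (hp : p ∈ openTower θ)
    {i j : ℤ} (hij : 0 < j ∨ j = 0 ∧ 0 < i) : p + (i + j * θ) ∉ openTower θ := by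
  intro hp'
  simp only [openTower, Set.mem_union, Set.mem_prod, Set.mem_Ioo, Prod.fst_add, Prod.fst_mul,
    Prod.fst_intCast, Prod.snd_add, Prod.snd_mul, Prod.snd_intCast] at hp hp'
  have hwidth : i + (j - 1) * θ.1 < 0 := by
    rcases hp with hp | hp <;> rcases hp' with hp' | hp' <;> linarith
  have hheight : i + (j - 1) * θ.2 > -1 ∨ i + j * θ.2 > -1 :=
    hp.imp (fun hp => by rcases hp' with hp' | hp' <;> linarith)
      (fun hp => by rcases hp' with hp' | hp' <;> linarith)
  rcases hij with hj | ⟨rfl, hi⟩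
  · have hij : i + j ≤ 0 := by
      have hj' : (1 : ℝ) ≤ j := by exact_mod_cast hj
      have hlt : (i + (j - 1) : ℝ) < 0 := by nlinarith
      have : i + (j - 1) < 0 := by exact_mod_cast hlt
      omega
    rcases (show j = 1 ∧ i = -1 ∨ j = 1 ∧ i ≤ -2 ∨ 2 ≤ j by omega) with
      ⟨rfl, rfl⟩ | ⟨rfl, hi⟩ | hj
    · push_cast at hp'
      rcases hp with hp | hp <;> rcases hp' with hp' | hp' <;> linarith
    · have hi' : (i : ℝ) ≤ -2 := by exact_mod_cast hi
      push_cast at hheight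
      rcases hheight with hy | hy <;> linarith
    · have hj' : (2 : ℝ) ≤ j := by exact_mod_cast hj
      have hij' : (i + j : ℝ) ≤ 0 := by exact_mod_cast hij
      rcases hheight with hy | hy <;> nlinarith
  · have hi' : (1 : ℝ) ≤ i := by exact_mod_cast hi
    push_cast at hp'
    rcases hp with hp | hp <;> rcases hp' with hp' | hp' <;> linarith

theorem eq_of_mem_towerTile (hθ : IsQuadraticUnit r s θ) (h₂ : 2 * θ.2 ≤ 1) (hp : p ∈ towerTile θ)
    (hgen : IsGeneric θ p) (hp' : p' ∈ towerTile θ) (hsub : p' - p ∈ unitRing θ) : p' = p := by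
  have hopen := hgen.mem_openTower hp
  have hopen' := (hgen.of_sub_mem hsub).mem_openTower hp'
  obtain ⟨i, j, hij⟩ := (mem_unitRing_iff hθ).1 hsub
  obtain rfl : p' = p + (i + j * θ) := by rw [← hij, add_sub_cancel]
  rcases (show (0 < j ∨ j = 0 ∧ 0 < i) ∨ (0 < -j ∨ -j = 0 ∧ 0 < -i) ∨ i = 0 ∧ j = 0 by omega)
    with h | h | ⟨rfl, rfl⟩
  · exact absurd hopen' (notMem_openTower_of_pos hθ.one_lt_fst h₂ hopen h)
  · refine absurd ?_ (notMem_openTower_of_pos hθ.one_lt_fst h₂ hopen' h)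
    convert hopen using 1
    push_cast
    ring
  · simp

end Uniqueness

/-! ### Negative norm: the Markov compactum -/

section Markov

variable {r : ℤ} {θ p : ℝ × ℝ} {e : ℤ → ℕ}

theorem natCast_eq_or_le_sub_one {d : ℕ} {k : ℤ} (h : (d : ℤ) ≤ k) :
    (d : ℝ) = k ∨ (d : ℝ) ≤ k - 1 :=
  h.eq_or_lt.imp (fun h => by exact_mod_cast h) (fun h => by exact_mod_cast Int.le_sub_one_of_lt h)

theorem le_toNat_of_mem_markovCompactum (he : e ∈ markovCompactum r) (n : ℤ) : e n ≤ r.toNat := by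
  have := he.1 n
  omega

theorem isBounded_towerTile (θ : ℝ × ℝ) : IsBounded (towerTile θ) :=
  ((Metric.isBounded_Icc _ _).prod (Metric.isBounded_Icc _ _)).union
    ((Metric.isBounded_Icc _ _).prod (Metric.isBounded_Icc _ _))

namespace IsQuadraticUnit

theorem snd_neg (hθ : IsQuadraticUnit r (-1) θ) : θ.2 < 0 := by
  have hmul := hθ.mul_eq
  push_cast at hmul
  nlinarith [hθ.one_lt_fst]

theorem mem_towerTile_iff_of_norm_neg (hθ : IsQuadraticUnit r (-1) θ) :
    p ∈ towerTile θ ↔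
      p.1 ∈ Set.Icc 0 θ.1 ∧ p.2 ∈ Set.Icc θ.2 1 ∧ (p.1 ≤ 1 ∨ p.2 ≤ 1 + θ.2) := by
  have hl := hθ.one_lt_fst
  have hm := hθ.snd_neg
  simp only [towerTile, Set.mem_union, Set.mem_prod, Set.mem_Icc]
  constructor
  · rintro (⟨⟨h₁, h₂⟩, h₃, h₄⟩ | ⟨⟨h₁, h₂⟩, h₃, h₄⟩)
    · exact ⟨⟨h₁, by linarith⟩, ⟨h₃, h₄⟩, Or.inl h₂⟩
    · exact ⟨⟨by linarith, h₂⟩, ⟨h₃, by linarith⟩, Or.inr h₄⟩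
  · rintro ⟨⟨h₁, h₂⟩, ⟨h₃, h₄⟩, h₅⟩
    rcases le_total p.1 1 with h | h
    · exact Or.inl ⟨⟨h₁, h⟩, h₃, h₄⟩
    · rcases h₅ with h₅ | h₅
      · exact Or.inl ⟨⟨h₁, h₅⟩, h₃, h₄⟩
      · exact Or.inr ⟨⟨h, h₂⟩, h₃, h₅⟩

theorem betaMap_mem_of_norm_neg (hθ : IsQuadraticUnit r (-1) θ) (hp : p ∈ towerTile θ) :
    (⌊p.1⌋₊ : ℤ) ≤ r ∧ ((⌊p.1⌋₊ : ℤ) = r → (betaMap θ p).1 ≤ 1) ∧ betaMap θ p ∈ towerTile θ := by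
  have hm' := neg_lt_of_abs_lt hθ.abs_snd_lt_one
  have hadd := hθ.add_eq
  have hmul := hθ.mul_eq
  push_cast at hmul
  rw [hθ.mem_towerTile_iff_of_norm_neg] at hp ⊢
  obtain ⟨⟨h₁, h₂⟩, ⟨h₃, h₄⟩, -⟩ := hp
  have hfloor := Nat.floor_le h₁
  have hlt := Nat.lt_floor_add_one p.1
  simp only [betaMap, Prod.fst_mul, Prod.fst_sub, Prod.fst_natCast, Prod.snd_mul, Prod.snd_sub,
    Prod.snd_natCast, Set.mem_Icc]
  set d := ⌊p.1⌋₊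
  have hd : (d : ℤ) ≤ r := by
    have : (d : ℝ) < r + 1 := by linarith
    exact Int.lt_add_one_iff.1 (by exact_mod_cast this)
  have hlast : (d : ℝ) = r → θ.1 * (p.1 - d) ≤ 1 := fun h => by nlinarith
  refine ⟨hd, fun h => hlast (by exact_mod_cast h), ⟨mul_nonneg (by linarith) (by linarith),
    by nlinarith⟩, ⟨by nlinarith, ?_⟩, ?_⟩
  · have : (d : ℝ) ≤ r := by exact_mod_cast hd
    nlinarith
  · exact (natCast_eq_or_le_sub_one hd).imp hlast fun h => by nlinarith

theorem future_mem_of_mem_markovCompactum (hθ : IsQuadraticUnit r (-1) θ)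
    (he : e ∈ markovCompactum r) (n : ℤ) :
    future θ.1 e n ∈ Set.Icc 0 (if e n = 0 then 1 else θ.1) := by
  have hl := hθ.one_lt_fst
  have hm' := neg_lt_of_abs_lt hθ.abs_snd_lt_one
  have hadd := hθ.add_eq
  have hmul := hθ.mul_eq
  push_cast at hmul
  have hinv : θ.1⁻¹ = -θ.2 := inv_eq_of_mul_eq_one_right (by linarith)
  have hle : ∀ n, (if e n = 0 then 1 else θ.1) ≤ θ.1 := fun n => by split_ifs <;> linarith
  refine future_mem_of_forall_mapsTo hl (le_toNat_of_mem_markovCompactum he)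
    (K := fun n => Set.Icc 0 (if e n = 0 then 1 else θ.1)) (fun _ => isClosed_Icc)
    (fun n => Set.nonempty_Icc.2 (by split_ifs <;> linarith))
    ((Metric.isBounded_Icc 0 θ.1).subset
      (Set.iUnion_subset fun n => Set.Icc_subset_Icc_right (hle n)))
    (fun n x hx => ⟨?_, ?_⟩) n
  · have := hx.1
    positivity
  · simp only [hinv]
    rcases natCast_eq_or_le_sub_one (he.1 n) with hn | hn
    · have hx1 := hx.2
      rw [if_pos (he.2 n (by exact_mod_cast hn))] at hx1
      have hne : e n ≠ 0 := fun h0 => by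
        rw [h0, Nat.cast_zero] at hn
        linarith
      rw [if_neg hne]
      nlinarith
    · have hx1 := hx.2.trans (hle (n + 1))
      split_ifs with h0
      · rw [h0, Nat.cast_zero]
        nlinarith
      · nlinarith

theorem past_mem_of_mem_markovCompactum (hθ : IsQuadraticUnit r (-1) θ)
    (he : e ∈ markovCompactum r) (n : ℤ) : past θ.2 e n ∈ Set.Icc θ.2 1 := by
  have hm := hθ.snd_neg
  have hadd := hθ.add_eq
  have hmul := hθ.mul_eq
  push_cast at hmul
  refine past_mem_of_forall_mapsTo hθ.abs_snd_lt_one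
    (le_toNat_of_mem_markovCompactum he) (K := fun _ => Set.Icc θ.2 1) (fun _ => isClosed_Icc)
    (fun _ => Set.nonempty_Icc.2 (by linarith))
    (by rw [Set.iUnion_const]; exact Metric.isBounded_Icc _ _)
    (fun n y hy => ?_) n
  have hn : (e n : ℝ) ≤ r := by exact_mod_cast he.1 n
  constructor <;> nlinarith [hy.1, hy.2]

theorem codePoint_mem_of_mem_markovCompactum (hθ : IsQuadraticUnit r (-1) θ)
    (he : e ∈ markovCompactum r) (n : ℤ) : codePoint θ e n ∈ towerTile θ := by
  have hm := hθ.snd_neg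
  have hadd := hθ.add_eq
  have hmul := hθ.mul_eq
  push_cast at hmul
  have hx := hθ.future_mem_of_mem_markovCompactum he n
  have hle : (if e n = 0 then 1 else θ.1) ≤ θ.1 := by split_ifs <;> linarith [hθ.one_lt_fst]
  refine hθ.mem_towerTile_iff_of_norm_neg.2
    ⟨⟨hx.1, hx.2.trans hle⟩, hθ.past_mem_of_mem_markovCompactum he n, ?_⟩
  rcases natCast_eq_or_le_sub_one (he.1 (n - 1)) with hn | hn
  · have h0 := he.2 (n - 1) (by exact_mod_cast hn)
    rw [sub_add_cancel] at h0
    rw [if_pos h0] at hx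
    exact Or.inl hx.2
  · right
    have hy := past_succ hθ.abs_snd_lt_one (le_toNat_of_mem_markovCompactum he) (n - 1)
    rw [sub_add_cancel] at hy
    simp only [codePoint]
    nlinarith [(hθ.past_mem_of_mem_markovCompactum he (n - 1)).1]

theorem isCodingTile_markov (hθ : IsQuadraticUnit r (-1) θ) :
    IsCodingTile θ (towerTile θ) (markovCompactum r) where
  isBounded := isBounded_towerTile θ
  exists_sub_mem := exists_sub_mem_towerTile hθ.one_lt_fst (lt_of_abs_lt hθ.abs_snd_lt_one)
  eq_of_sub_mem _ hp hgen _ hp' := eq_of_mem_towerTile hθ (by linarith [hθ.snd_neg]) hp hgen hp'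
  exists_digit_le := ⟨r.toNat, fun _ => le_toNat_of_mem_markovCompactum⟩
  codePoint_mem _ he := hθ.codePoint_mem_of_mem_markovCompactum he
  mapsTo_betaMap _ hp := (hθ.betaMap_mem_of_norm_neg hp).2.2
  floor_mem x hx hgen hstep := by
    refine ⟨fun n => (hθ.betaMap_mem_of_norm_neg (hx n)).1, fun n hn => Nat.floor_eq_zero.2 ?_⟩
    refine lt_of_le_of_ne ?_ (hgen (n + 1) 1 (one_mem _)).1
    rw [hstep]
    exact (hθ.betaMap_mem_of_norm_neg (hx n)).2.1 hn

end IsQuadraticUnit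

end Markov

/-! ### Positive norm: the sofic compactum -/

/-- The image of `towerTile θ` under the point reflection `p ↦ θ - p`. -/
def soficTile (θ : ℝ × ℝ) : Set (ℝ × ℝ) := {p | θ - p ∈ towerTile θ}

/-- A block of the form `(r - 2) … (r - 2) (r - 1)` starts at time `n`. -/
def IsLarge (r : ℤ) (e : ℤ → ℕ) (n : ℤ) : Prop :=
  ∃ k, n ≤ k ∧ (∀ i, n ≤ i → i < k → (e i : ℤ) = r - 2) ∧ (e k : ℤ) = r - 1

section Sofic

variable {r : ℤ} {θ p : ℝ × ℝ} {e : ℤ → ℕ} {n : ℤ}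

theorem le_toNat_of_mem_soficCompactum (he : e ∈ soficCompactum r) (n : ℤ) : e n ≤ r.toNat := by
  have := he.1 n
  omega

theorem IsLarge.of_eq_sub_two (hn : (e n : ℤ) = r - 2) (h : IsLarge r e (n + 1)) :
    IsLarge r e n := by
  obtain ⟨k, hk, hi, he⟩ := h
  refine ⟨k, by omega, fun i hni hik => ?_, he⟩
  rcases hni.eq_or_lt with rfl | hni
  · exact hn
  · exact hi i hni hik

theorem not_isLarge_of_eq_sub_one (he : e ∈ soficCompactum r) (hn : (e n : ℤ) = r - 1) :
    ¬IsLarge r e (n + 1) := fun ⟨k, hk, hi, hek⟩ =>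
  he.2 n k hk ⟨hn, fun i hni hik => hi i hni hik, hek⟩

theorem reverse_mem_soficCompactum (he : e ∈ soficCompactum r) :
    (fun i => e (-i)) ∈ soficCompactum r :=
  ⟨fun n => he.1 (-n), fun a b hab ⟨ha, hi, hb⟩ => he.2 (-b) (-a) (by omega)
    ⟨hb, fun i hbi hia => by simpa using hi (-i) (by omega) (by omega), ha⟩⟩

theorem not_isLarge_or_not_isLarge_reverse (he : e ∈ soficCompactum r) (n : ℤ) :
    ¬IsLarge r e n ∨ ¬IsLarge r (fun i => e (-i)) (1 - n) := by
  by_contra! h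
  obtain ⟨⟨k, hk, hi, hek⟩, ⟨j, hj, hi', hej⟩⟩ := h
  refine he.2 (-j) k (by omega) ⟨hej, fun i hji hik => ?_, hek⟩
  rcases lt_or_ge i n with hin | hin
  · simpa using hi' (-i) (by omega) (by omega)
  · exact hi i hin hik

namespace IsQuadraticUnit

theorem snd_pos (hθ : IsQuadraticUnit r 1 θ) : 0 < θ.2 := by
  have hmul := hθ.mul_eq
  push_cast at hmul
  exact pos_of_mul_pos_right (by linarith) (zero_lt_one.trans hθ.one_lt_fst).le

theorem two_mul_snd_le_one (hθ : IsQuadraticUnit r 1 θ) : 2 * θ.2 ≤ 1 := by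
  have hl := hθ.one_lt_fst
  have hadd := hθ.add_eq
  have hmul := hθ.mul_eq
  push_cast at hmul
  have hr : (2 : ℝ) < r := by nlinarith
  have hr3 : (3 : ℝ) ≤ r := by
    have : 2 < r := by exact_mod_cast hr
    exact_mod_cast this
  nlinarith [hθ.snd_pos]

theorem mem_soficTile_iff (hθ : IsQuadraticUnit r 1 θ) :
    p ∈ soficTile θ ↔
      p.1 ∈ Set.Icc 0 θ.1 ∧ p.2 ∈ Set.Icc (-1) 0 ∧ (p.1 ≤ θ.1 - 1 ∨ θ.2 - 1 ≤ p.2) := by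
  have hl := hθ.one_lt_fst
  have hm := hθ.snd_pos
  simp only [soficTile, towerTile, Set.mem_ofPred_eq, Set.mem_union, Set.mem_prod, Set.mem_Icc,
    Prod.fst_sub, Prod.snd_sub]
  constructor
  · rintro (⟨⟨h₁, h₂⟩, h₃, h₄⟩ | ⟨⟨h₁, h₂⟩, h₃, h₄⟩)
    · exact ⟨⟨by linarith, by linarith⟩, ⟨by linarith, by linarith⟩, Or.inr (by linarith)⟩
    · exact ⟨⟨by linarith, by linarith⟩, ⟨by linarith, by linarith⟩, Or.inl (by linarith)⟩
  · rintro ⟨⟨h₁, h₂⟩, ⟨h₃, h₄⟩, h₅⟩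
    rcases le_total p.1 (θ.1 - 1) with h | h
    · exact Or.inr ⟨⟨by linarith, by linarith⟩, by linarith, by linarith⟩
    · rcases h₅ with h₅ | h₅
      · exact Or.inr ⟨⟨by linarith, by linarith⟩, by linarith, by linarith⟩
      · exact Or.inl ⟨⟨by linarith, by linarith⟩, by linarith, by linarith⟩

theorem isBounded_soficTile (hθ : IsQuadraticUnit r 1 θ) : IsBounded (soficTile θ) :=
  ((Metric.isBounded_Icc 0 θ.1).prod (Metric.isBounded_Icc (-1) 0)).subset fun _ hp =>
    ⟨(hθ.mem_soficTile_iff.1 hp).1, (hθ.mem_soficTile_iff.1 hp).2.1⟩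

theorem floor_le_of_mem_soficTile (hθ : IsQuadraticUnit r 1 θ) (hp : p ∈ soficTile θ) :
    (⌊p.1⌋₊ : ℤ) ≤ r - 1 := by
  obtain ⟨⟨h₁, h₂⟩, -⟩ := hθ.mem_soficTile_iff.1 hp
  have hlt : (⌊p.1⌋₊ : ℝ) < r := by linarith [Nat.floor_le h₁, hθ.add_eq, hθ.snd_pos]
  exact Int.le_sub_one_of_lt (by exact_mod_cast hlt)

theorem betaMap_fst_le_of_eq_sub_one (hθ : IsQuadraticUnit r 1 θ) (hp : p ∈ soficTile θ)
    (hd : (⌊p.1⌋₊ : ℤ) = r - 1) : (betaMap θ p).1 ≤ θ.1 - 1 := by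
  have hadd := hθ.add_eq
  have hmul := hθ.mul_eq
  push_cast at hmul
  have hd : (⌊p.1⌋₊ : ℝ) = r - 1 := by exact_mod_cast hd
  simp only [betaMap, Prod.fst_mul, Prod.fst_sub, Prod.fst_natCast, hd]
  nlinarith [hθ.one_lt_fst, (hθ.mem_soficTile_iff.1 hp).1.2]

theorem betaMap_fst_le_of_eq_sub_two (hθ : IsQuadraticUnit r 1 θ) (hp : p.1 ≤ θ.1 - 1)
    (hd : (⌊p.1⌋₊ : ℤ) = r - 2) : (betaMap θ p).1 ≤ θ.1 - 1 := by
  have hadd := hθ.add_eq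
  have hmul := hθ.mul_eq
  push_cast at hmul
  have hd : (⌊p.1⌋₊ : ℝ) = r - 2 := by exact_mod_cast hd
  simp only [betaMap, Prod.fst_mul, Prod.fst_sub, Prod.fst_natCast, hd]
  nlinarith [hθ.one_lt_fst]

theorem betaMap_mem_soficTile (hθ : IsQuadraticUnit r 1 θ) (hp : p ∈ soficTile θ) :
    betaMap θ p ∈ soficTile θ := by
  have hm := hθ.snd_pos
  have hm1 := hθ.two_mul_snd_le_one
  have hadd := hθ.add_eq
  have hmul := hθ.mul_eq
  push_cast at hmul
  have hone := hθ.betaMap_fst_le_of_eq_sub_one hp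
  have htwo := hθ.betaMap_fst_le_of_eq_sub_two (p := p)
  have hd := hθ.floor_le_of_mem_soficTile hp
  rw [hθ.mem_soficTile_iff] at hp ⊢
  obtain ⟨⟨h₁, _⟩, ⟨h₃, h₄⟩, h₅⟩ := hp
  have hfloor := Nat.floor_le h₁
  have hlt := Nat.lt_floor_add_one p.1
  simp only [betaMap, Prod.fst_mul, Prod.fst_sub, Prod.fst_natCast, Prod.snd_mul, Prod.snd_sub,
    Prod.snd_natCast, Set.mem_Icc] at hone htwo ⊢
  set d := ⌊p.1⌋₊
  refine ⟨⟨mul_nonneg (by linarith) (by linarith), by nlinarith⟩, ?_⟩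
  rcases (show (d : ℤ) = r - 1 ∨ (d : ℤ) = r - 2 ∨ (d : ℤ) ≤ r - 3 by omega) with hd | hd | hd
  · have hd' : (d : ℝ) = r - 1 := by exact_mod_cast hd
    have hy : θ.2 - 1 ≤ p.2 := h₅.resolve_left (by linarith)
    exact ⟨⟨by nlinarith, by nlinarith⟩, Or.inl (hone hd)⟩
  · have hd' : (d : ℝ) = r - 2 := by exact_mod_cast hd
    exact ⟨⟨by nlinarith, by nlinarith⟩, h₅.imp (fun h => htwo h hd) fun h => by nlinarith⟩
  · have hd' : (d : ℝ) ≤ r - 3 := by exact_mod_cast hd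
    exact ⟨⟨by nlinarith, by nlinarith⟩, Or.inr (by nlinarith)⟩

open Classical in
theorem future_mem_of_mem_soficCompactum (hθ : IsQuadraticUnit r 1 θ) (he : e ∈ soficCompactum r)
    (n : ℤ) : future θ.1 e n ∈ Set.Icc 0 (if IsLarge r e n then θ.1 else θ.1 - 1) := by
  have hl := hθ.one_lt_fst
  have hadd := hθ.add_eq
  have hmul := hθ.mul_eq
  push_cast at hmul
  have hinv : θ.1⁻¹ = θ.2 := inv_eq_of_mul_eq_one_right hmul
  have hle : ∀ n, (if IsLarge r e n then θ.1 else θ.1 - 1) ≤ θ.1 := fun n => by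
    split_ifs <;> linarith
  have hge : ∀ n, θ.1 - 1 ≤ if IsLarge r e n then θ.1 else θ.1 - 1 := fun n => by
    split_ifs <;> linarith
  refine future_mem_of_forall_mapsTo hl (le_toNat_of_mem_soficCompactum he)
    (K := fun n => Set.Icc 0 (if IsLarge r e n then θ.1 else θ.1 - 1)) (fun _ => isClosed_Icc)
    (fun n => Set.nonempty_Icc.2 (by linarith [hge n]))
    ((Metric.isBounded_Icc 0 θ.1).subset
      (Set.iUnion_subset fun n => Set.Icc_subset_Icc_right (hle n)))
    (fun n x hx => ⟨add_nonneg (e n).cast_nonneg (mul_nonneg (by positivity) hx.1), ?_⟩) n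
  have hx1 := hx.2
  simp only [hinv]
  rcases (show (e n : ℤ) = r - 1 ∨ (e n : ℤ) = r - 2 ∨ (e n : ℤ) ≤ r - 3 by
    have := he.1 n
    omega) with hn | hn | hn
  · have hn' : (e n : ℝ) = r - 1 := by exact_mod_cast hn
    rw [if_neg (not_isLarge_of_eq_sub_one he hn)] at hx1
    rw [if_pos ⟨n, le_rfl, fun i hi hi' => absurd hi' hi.not_gt, hn⟩]
    nlinarith
  · have hn' : (e n : ℝ) = r - 2 := by exact_mod_cast hn
    split_ifs at hx1 with hlarge
    · rw [if_pos (hlarge.of_eq_sub_two hn)]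
      nlinarith
    · exact le_trans (by nlinarith) (hge n)
  · have hn' : (e n : ℝ) ≤ r - 3 := by exact_mod_cast hn
    exact le_trans (by nlinarith [hle (n + 1)]) (hge n)

theorem past_eq_neg_mul_future_reverse (hθ : IsQuadraticUnit r 1 θ) (e : ℤ → ℕ) (n : ℤ) :
    past θ.2 e n = -(θ.2 * future θ.1 (fun i => e (-i)) (1 - n)) := by
  have hinv : θ.1⁻¹ = θ.2 := inv_eq_of_mul_eq_one_right (by simpa using hθ.mul_eq)
  rw [past_eq_mul_tsum, future, hinv]
  simp only [neg_add_rev, sub_eq_add_neg, neg_neg, add_comm, add_left_comm]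

theorem codePoint_mem_of_mem_soficCompactum (hθ : IsQuadraticUnit r 1 θ)
    (he : e ∈ soficCompactum r) (n : ℤ) : codePoint θ e n ∈ soficTile θ := by
  classical
  have hm := hθ.snd_pos
  have hmul := hθ.mul_eq
  push_cast at hmul
  have hx := hθ.future_mem_of_mem_soficCompactum he n
  have hy := hθ.future_mem_of_mem_soficCompactum (reverse_mem_soficCompactum he) (1 - n)
  have hle : ∀ q : Prop, (if q then θ.1 else θ.1 - 1) ≤ θ.1 := fun q => by split_ifs <;> linarith
  refine hθ.mem_soficTile_iff.2 ⟨⟨hx.1, hx.2.trans (hle _)⟩, ?_, ?_⟩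
  all_goals simp only [codePoint, hθ.past_eq_neg_mul_future_reverse]
  · have := hy.2.trans (hle _)
    exact ⟨by nlinarith, by nlinarith [hy.1]⟩
  · refine (not_isLarge_or_not_isLarge_reverse he n).imp (fun h => ?_) (fun h => ?_)
    · rw [if_neg h] at hx
      exact hx.2
    · rw [if_neg h] at hy
      nlinarith [hy.2]

theorem exists_sub_mem_soficTile (hθ : IsQuadraticUnit r 1 θ) (p : ℝ × ℝ) :
    ∃ p' ∈ soficTile θ, p' - p ∈ unitRing θ := by
  obtain ⟨q, hq, hqp⟩ :=
    exists_sub_mem_towerTile hθ.one_lt_fst (lt_of_abs_lt hθ.abs_snd_lt_one) (θ - p)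
  refine ⟨θ - q, by simpa [soficTile] using hq, ?_⟩
  convert neg_mem hqp using 1
  ring

theorem eq_of_mem_soficTile (hθ : IsQuadraticUnit r 1 θ) {p' : ℝ × ℝ} (hp : p ∈ soficTile θ)
    (hgen : IsGeneric θ p) (hp' : p' ∈ soficTile θ) (hsub : p' - p ∈ unitRing θ) : p' = p := by
  refine sub_right_injective (eq_of_mem_towerTile hθ hθ.two_mul_snd_le_one hp
    (hgen.const_sub self_mem_unitRing) hp' ?_)
  convert neg_mem hsub using 1
  ring

theorem floor_mem_soficCompactum (hθ : IsQuadraticUnit r 1 θ) {x : ℤ → ℝ × ℝ}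
    (hx : ∀ n, x n ∈ soficTile θ) (hstep : ∀ n, x (n + 1) = betaMap θ (x n)) :
    (fun n => ⌊(x n).1⌋₊) ∈ soficCompactum r := by
  refine ⟨fun n => hθ.floor_le_of_mem_soficTile (hx n), fun a b hab ⟨ha, hi, hb⟩ => ?_⟩
  have hsmall : ∀ i, a + 1 ≤ i → i ≤ b → (x i).1 ≤ θ.1 - 1 := by
    intro i hai
    induction i, hai using Int.leInduction with
    | base =>
      rw [hstep]
      exact fun _ => hθ.betaMap_fst_le_of_eq_sub_one (hx a) ha
    | succ i hai ih =>
      intro hib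
      rw [hstep]
      exact hθ.betaMap_fst_le_of_eq_sub_two (ih (by omega)) (hi i hai hib)
  have hfloor := Nat.floor_le (hθ.mem_soficTile_iff.1 (hx b)).1.1
  have hb' : (⌊(x b).1⌋₊ : ℝ) = r - 1 := by exact_mod_cast hb
  linarith [hsmall b hab le_rfl, hθ.add_eq, hθ.snd_pos]

theorem isCodingTile_sofic (hθ : IsQuadraticUnit r 1 θ) :
    IsCodingTile θ (soficTile θ) (soficCompactum r) where
  isBounded := hθ.isBounded_soficTile
  exists_sub_mem := hθ.exists_sub_mem_soficTile
  eq_of_sub_mem _ hp hgen _ hp' := hθ.eq_of_mem_soficTile hp hgen hp'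
  exists_digit_le := ⟨r.toNat, fun _ => le_toNat_of_mem_soficCompactum⟩
  codePoint_mem _ he := hθ.codePoint_mem_of_mem_soficCompactum he
  mapsTo_betaMap _ hp := hθ.betaMap_mem_soficTile hp
  floor_mem _ hx _ hstep := hθ.floor_mem_soficCompactum hx hstep

end IsQuadraticUnit

end Sofic

/-! ### From the plane to the torus -/

theorem IsSaddle.fst_ne_snd {θ : ℝ × ℝ} (hθ : IsSaddle θ) : θ.1 ≠ θ.2 :=
  ((lt_of_abs_lt hθ.abs_snd_lt_one).trans hθ.one_lt_fst).ne'

section Torus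

variable {M : GL (Fin 2) ℤ}

/-- `toTorus` as a homomorphism of groups. -/
def toTorusHom : (Fin 2 → ℝ) →+ Torus where
  toFun := toTorus
  map_zero' := by
    funext _
    simp [toTorus]
  map_add' x y := by
    funext i
    simp [toTorus]

theorem continuous_toTorusHom : Continuous toTorusHom :=
  continuous_pi fun i => (AddCircle.continuous_mk' 1).comp (continuous_apply i)

theorem toTorusHom_eq_zero_iff {x : Fin 2 → ℝ} :
    toTorusHom x = 0 ↔ ∃ z : Fin 2 → ℤ, (fun i => (z i : ℝ)) = x := by
  constructor
  · intro h
    choose z hz using fun i => (AddCircle.coe_eq_zero_iff 1).1 (congrFun h i)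
    exact ⟨z, funext fun i => by simpa using hz i⟩
  · rintro ⟨z, rfl⟩
    exact funext fun i => (AddCircle.coe_eq_zero_iff 1).2 ⟨z i, by simp⟩

theorem act_toTorusHom (x : Fin 2 → ℝ) :
    act M (toTorusHom x) = toTorusHom ((M.val.map (Int.cast : ℤ → ℝ)).mulVec x) := by
  funext i
  change ∑ j, M.val i j • ((x j : ℝ) : UnitAddCircle) =
    ((∑ j, (M.val i j : ℝ) * x j : ℝ) : UnitAddCircle)
  simp [Fin.sum_univ_two, ← zsmul_eq_mul]

theorem act_mul (A B : GL (Fin 2) ℤ) (x : Torus) : act (A * B) x = act A (act B x) := by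
  funext i
  change ∑ j, (A * B).val i j • x j = ∑ j, A.val i j • ∑ k, B.val j k • x k
  simp only [Units.val_mul, Matrix.mul_apply, Fin.sum_univ_two, add_smul, mul_smul, smul_add]
  abel

theorem act_one (x : Torus) : act 1 x = x := by
  funext i
  change ∑ j, (1 : GL (Fin 2) ℤ).val i j • x j = x i
  simp [Matrix.one_apply]

theorem act_injective (M : GL (Fin 2) ℤ) : Function.Injective (act M) :=
  Function.LeftInverse.injective (g := act M⁻¹) fun x => by
    rw [← act_mul, inv_mul_cancel, act_one]

end Torus

section PlaneMap

variable {V : Type*} [AddCommGroup V] [Module ℝ V] {x x' : V} {θ : ℝ × ℝ}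

/-- The linear map on `ℝ × ℝ` with `1 ↦ x` and `θ ↦ x'`, by Cramer's rule. It is meaningful for
`θ.1 ≠ θ.2` only. -/
def planeMap (θ : ℝ × ℝ) (x x' : V) : ℝ × ℝ →ₗ[ℝ] V :=
  ((θ.1 - θ.2)⁻¹ • (θ.1 • LinearMap.snd ℝ ℝ ℝ - θ.2 • LinearMap.fst ℝ ℝ ℝ)).smulRight x +
    ((θ.1 - θ.2)⁻¹ • (LinearMap.fst ℝ ℝ ℝ - LinearMap.snd ℝ ℝ ℝ)).smulRight x'

theorem planeMap_apply (p : ℝ × ℝ) :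
    planeMap θ x x' p = ((θ.1 - θ.2)⁻¹ * (θ.1 * p.2 - θ.2 * p.1)) • x +
      ((θ.1 - θ.2)⁻¹ * (p.1 - p.2)) • x' := rfl

theorem exists_eq_smul_add_smul (hθ : θ.1 ≠ θ.2) (p : ℝ × ℝ) :
    ∃ a b : ℝ, p = a • (1 : ℝ × ℝ) + b • θ := by
  have hne := sub_ne_zero.2 hθ
  refine ⟨(θ.1 - θ.2)⁻¹ * (θ.1 * p.2 - θ.2 * p.1), (θ.1 - θ.2)⁻¹ * (p.1 - p.2), ?_⟩
  ext
  all_goals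
    simp only [Prod.fst_add, Prod.smul_fst, Prod.fst_one, Prod.snd_add, Prod.smul_snd,
      Prod.snd_one, smul_eq_mul]
    field_simp
    ring

theorem planeMap_smul_add_smul (hθ : θ.1 ≠ θ.2) (a b : ℝ) :
    planeMap θ x x' (a • (1 : ℝ × ℝ) + b • θ) = a • x + b • x' := by
  have hne := sub_ne_zero.2 hθ
  rw [planeMap_apply]
  congr 2
  all_goals
    simp only [Prod.fst_add, Prod.smul_fst, Prod.fst_one, Prod.snd_add, Prod.smul_snd,
      Prod.snd_one, smul_eq_mul]
    field_simp
    ring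

theorem planeMap_mul {r s : ℤ} (hθ : IsQuadraticUnit r s θ) {f : V →ₗ[ℝ] V}
    (hx : f x = x') (hx' : f x' = (r : ℝ) • x' - (s : ℝ) • x) (p : ℝ × ℝ) :
    planeMap θ x x' (θ * p) = f (planeMap θ x x' p) := by
  have hne := hθ.fst_ne_snd
  obtain ⟨a, b, rfl⟩ := exists_eq_smul_add_smul hne p
  have hmul : θ * (a • (1 : ℝ × ℝ) + b • θ) =
      (-(b * s)) • (1 : ℝ × ℝ) + (a + b * r) • θ := by
    rw [mul_add, mul_smul_comm, mul_smul_comm, mul_one, hθ.mul_self]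
    ext <;> simp <;> ring
  rw [hmul, planeMap_smul_add_smul hne, planeMap_smul_add_smul hne, map_add, map_smul, map_smul,
    hx, hx']
  module

theorem planeMap_injective (hθ : θ.1 ≠ θ.2) (hx : LinearIndependent ℝ ![x, x']) :
    Function.Injective (planeMap θ x x') := by
  rw [injective_iff_map_eq_zero]
  intro p hp
  obtain ⟨a, b, rfl⟩ := exists_eq_smul_add_smul hθ p
  rw [planeMap_smul_add_smul hθ] at hp
  obtain ⟨rfl, rfl⟩ := LinearIndependent.pair_iff.1 hx a b hp
  simp

end PlaneMap

/-- The composite of `planeMap θ q q'` with the projection of the plane to the torus. -/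
def planeToTorus (θ : ℝ × ℝ) (q q' : Fin 2 → ℤ) : ℝ × ℝ →+ Torus :=
  toTorusHom.comp (planeMap θ (fun i => (q i : ℝ)) fun i => (q' i : ℝ)).toAddMonoidHom

section PlaneToTorus

variable {M : GL (Fin 2) ℤ} {θ : ℝ × ℝ} {q q' : Fin 2 → ℤ}

theorem continuous_planeToTorus : Continuous (planeToTorus θ q q') :=
  continuous_toTorusHom.comp (planeMap θ _ _).continuous_of_finiteDimensional

theorem planeMap_intCast_add_mul (hθ : θ.1 ≠ θ.2) (i j : ℤ) :
    planeMap θ (fun k => (q k : ℝ)) (fun k => (q' k : ℝ)) (i + j * θ) =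
      fun k => ((i • q + j • q') k : ℝ) := by
  have heq : (i + j * θ : ℝ × ℝ) = (i : ℝ) • (1 : ℝ × ℝ) + (j : ℝ) • θ := by ext <;> simp
  rw [heq, planeMap_smul_add_smul hθ]
  funext k
  simp

theorem planeToTorus_eq_zero_of_mem {r s : ℤ} (hθ : IsQuadraticUnit r s θ) {v : ℝ × ℝ}
    (hv : v ∈ unitRing θ) : planeToTorus θ q q' v = 0 := by
  obtain ⟨i, j, rfl⟩ := (mem_unitRing_iff hθ).1 hv
  exact toTorusHom_eq_zero_iff.2 ⟨i • q + j • q',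
    (planeMap_intCast_add_mul hθ.fst_ne_snd i j).symm⟩

theorem mulVec_mulVec_eq (A : Matrix (Fin 2) (Fin 2) ℤ) (q : Fin 2 → ℤ) :
    A.mulVec (A.mulVec q) = A.trace • A.mulVec q - A.det • q := by
  funext i
  fin_cases i <;>
    simp [Matrix.mulVec, dotProduct, Fin.sum_univ_two, Matrix.trace_fin_two,
      Matrix.det_fin_two] <;>
    ring

theorem planeToTorus_mul (hθ : IsQuadraticUnit M.val.trace M.val.det θ) (p : ℝ × ℝ) :
    planeToTorus θ q (M.val.mulVec q) (θ * p) = act M (planeToTorus θ q (M.val.mulVec q) p) := by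
  have hcast : ∀ z : Fin 2 → ℤ, (M.val.map (Int.cast : ℤ → ℝ)).mulVecLin (fun i => (z i : ℝ)) =
      fun i => (M.val.mulVec z i : ℝ) := fun z => by
    funext i
    exact ((Int.castRingHom ℝ).map_mulVec M.val z i).symm
  change toTorusHom (planeMap θ _ _ _) = act M (toTorusHom (planeMap θ _ _ _))
  rw [planeMap_mul hθ (hcast q), act_toTorusHom, Matrix.mulVecLin_apply]
  rw [hcast, mulVec_mulVec_eq]
  funext i
  simp only [Pi.sub_apply, Pi.smul_apply, smul_eq_mul, Int.cast_sub, Int.cast_mul]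

theorem act_zpow_planeToTorus (hθ : IsQuadraticUnit M.val.trace M.val.det θ) (n : ℤ) (p : ℝ × ℝ) :
    act (M ^ n) (planeToTorus θ q (M.val.mulVec q) p) =
      planeToTorus θ q (M.val.mulVec q) (θ ^ n * p) := by
  have hstep : ∀ n : ℤ, act (M ^ (n + 1)) (planeToTorus θ q (M.val.mulVec q) p) =
        planeToTorus θ q (M.val.mulVec q) (θ ^ (n + 1) * p) ↔
      act (M ^ n) (planeToTorus θ q (M.val.mulVec q) p) =
        planeToTorus θ q (M.val.mulVec q) (θ ^ n * p) := fun n => by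
    rw [add_comm, zpow_one_add, act_mul, add_comm, zpow_succ_eq_mul hθ.isUnit, mul_assoc,
      planeToTorus_mul hθ]
    exact (act_injective M).eq_iff
  induction n with
  | zero => simp [act_one]
  | succ k ih => exact (hstep k).2 ih
  | pred k ih => exact (hstep (-k - 1)).1 (by simpa using ih)

end PlaneToTorus

/-! ### Homoclinic points and the coding map -/

theorem tendsto_zpow_atTop_nhds_zero {x : ℝ} (hx : |x| < 1) :
    Tendsto (fun n : ℤ => x ^ n) atTop (𝓝 0) := by
  rw [← Nat.map_cast_int_atTop, tendsto_map'_iff]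
  simpa only [Function.comp_def, zpow_natCast] using tendsto_pow_atTop_nhds_zero_of_abs_lt_one hx

theorem tendsto_zpow_atBot_nhds_zero {x : ℝ} (hx : 1 < x) :
    Tendsto (fun n : ℤ => x ^ n) atBot (𝓝 0) := by
  have habs : |x⁻¹| < 1 := by
    rw [abs_of_pos (inv_pos.2 (one_pos.trans hx))]
    exact inv_lt_one_of_one_lt₀ hx
  simpa only [Function.comp_def, inv_zpow', neg_neg] using
    (tendsto_zpow_atTop_nhds_zero habs).comp tendsto_neg_atBot_atTop

theorem zpow_mul_inl (θ : ℝ × ℝ) (n : ℤ) (x : ℝ) :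
    θ ^ n * ((x, 0) : ℝ × ℝ) = (θ.1 ^ n * x, 0) := by
  ext <;> simp [Prod.pow_fst]

theorem zpow_mul_inr (θ : ℝ × ℝ) (n : ℤ) (x : ℝ) :
    θ ^ n * ((0, x) : ℝ × ℝ) = (0, θ.2 ^ n * x) := by
  ext <;> simp [Prod.pow_snd]

theorem planeToTorus_one_zero {θ : ℝ × ℝ} {r s : ℤ} (hθ : IsQuadraticUnit r s θ)
    (q q' : Fin 2 → ℤ) : planeToTorus θ q q' (1, 0) = planeToTorus θ q q' (0, -1) := by
  rw [← sub_eq_zero, ← map_sub]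
  convert planeToTorus_eq_zero_of_mem hθ (one_mem (unitRing θ)) using 2
  ext <;> simp

section Coding

variable {M : GL (Fin 2) ℤ} {θ : ℝ × ℝ} {q : Fin 2 → ℤ}

theorem isHomoclinic_planeToTorus (hθ : IsQuadraticUnit M.val.trace M.val.det θ) :
    IsHomoclinic M (planeToTorus θ q (M.val.mulVec q) (1, 0)) := by
  -- The point is the image of `(1, 0)` on the unstable and of `(0, -1)` on the stable line.
  have hψ := (continuous_planeToTorus (θ := θ) (q := q) (q' := M.val.mulVec q)).tendsto (0, 0)
  rw [← Prod.zero_eq_mk, map_zero, Prod.zero_eq_mk] at hψ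
  constructor
  · simp only [planeToTorus_one_zero hθ, act_zpow_planeToTorus hθ, zpow_mul_inr]
    have hstable := (tendsto_zpow_atTop_nhds_zero hθ.abs_snd_lt_one).mul_const (-1)
    rw [zero_mul] at hstable
    exact hψ.comp (tendsto_const_nhds.prodMk_nhds hstable)
  · simp only [act_zpow_planeToTorus hθ, zpow_mul_inl, mul_one]
    have hunstable := tendsto_zpow_atBot_nhds_zero hθ.one_lt_fst
    exact hψ.comp (hunstable.prodMk_nhds tendsto_const_nhds)

theorem hasSum_smul_act_zpow (hθ : IsQuadraticUnit M.val.trace M.val.det θ) {e : ℤ → ℕ} {B : ℕ}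
    (he : ∀ n, e n ≤ B) :
    HasSum (fun n : ℤ => e n • act (M ^ (-n)) (planeToTorus θ q (M.val.mulVec q) (1, 0)))
      (planeToTorus θ q (M.val.mulVec q) (codePoint θ e 0)) := by
  set ψ := planeToTorus θ q (M.val.mulVec q) with hψ
  have hmap {f : ℕ → ℝ × ℝ} {p : ℝ × ℝ} (hf : HasSum f p) : HasSum (ψ ∘ f) (ψ p) :=
    hf.map ψ continuous_planeToTorus
  have hfuture : HasSum (fun n : ℕ => e n • act (M ^ (-(n : ℤ))) (ψ (1, 0)))
      (ψ (future θ.1 e 0, 0)) := by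
    convert hmap ((hasSum_future hθ.one_lt_fst he 0).prodMk hasSum_zero) using 2 with n
    rw [act_zpow_planeToTorus hθ, ← map_nsmul, zpow_mul_inl]
    simp only [Function.comp_apply, hψ, Prod.smul_mk, nsmul_eq_mul, mul_one, zero_add, mul_zero,
      zpow_neg, zpow_natCast, inv_pow]
  have hpast : HasSum (fun n : ℕ => e (-(n + 1)) • act (M ^ (- -((n : ℤ) + 1))) (ψ (1, 0)))
      (ψ (0, past θ.2 e 0)) := by
    convert hmap (hasSum_zero.prodMk (hasSum_past hθ.abs_snd_lt_one he 0)) using 2 with n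
    rw [planeToTorus_one_zero hθ, act_zpow_planeToTorus hθ, ← map_nsmul, zpow_mul_inr, neg_neg]
    simp only [Function.comp_apply, hψ, Prod.smul_mk, nsmul_eq_mul, mul_neg, mul_one, zero_sub,
      mul_zero, ← Nat.cast_add_one, zpow_natCast]
  have hcode : ψ (codePoint θ e 0) = ψ (future θ.1 e 0, 0) + ψ (0, past θ.2 e 0) := by
    rw [← map_add, Prod.mk_add_mk, add_zero, zero_add, codePoint]
  rw [hcode]
  exact hfuture.of_nat_of_neg_add_one hpast

theorem tendsto_partialSum (hθ : IsQuadraticUnit M.val.trace M.val.det θ) {e : ℤ → ℕ} {B : ℕ}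
    (he : ∀ n, e n ≤ B) :
    Tendsto (partialSum M (planeToTorus θ q (M.val.mulVec q) (1, 0)) e) atTop
      (𝓝 (planeToTorus θ q (M.val.mulVec q) (codePoint θ e 0))) :=
  (hasSum_smul_act_zpow hθ he).comp Finset.tendsto_Icc_neg

end Coding

/-! ### The number of codes of a point -/

theorem encard_setOf_eq_relIndex {E A B : Type*} [AddCommGroup A] [AddCommGroup B] {ψ : A →+ B}
    {L : AddSubgroup A} (hL : L ≤ ψ.ker) (hindex : L.relIndex ψ.ker ≠ 0) {c : E → A} {X : Set E}
    {p : A} (hcode : ∀ p', ψ p' = ψ p → ∃! e, e ∈ X ∧ c e - p' ∈ L) :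
    {e ∈ X | ψ (c e) = ψ p}.encard = L.relIndex ψ.ker := by
  -- The map `e ↦ c e - p` is a bijection onto `ψ.ker ⧸ L`.
  have hker : ∀ e, ψ (c e) = ψ p → c e - p ∈ ψ.ker := fun e he => by
    rw [AddMonoidHom.mem_ker, map_sub, he, sub_self]
  let g : {e ∈ X | ψ (c e) = ψ p} → ψ.ker ⧸ L.addSubgroupOf ψ.ker :=
    fun e => QuotientAddGroup.mk ⟨c e - p, hker e e.2.2⟩
  have hinj : Function.Injective g := by
    rintro ⟨e, heX, he⟩ ⟨e', heX', he'⟩ heq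
    have hmem := QuotientAddGroup.eq.1 heq.symm
    rw [AddSubgroup.mem_addSubgroupOf] at hmem
    have hsub : c e - c e' ∈ L := by
      convert hmem using 1
      simp
    exact Subtype.ext ((hcode (c e') he').unique ⟨heX, hsub⟩ ⟨heX', by simp [L.zero_mem]⟩)
  have hsurj : Function.Surjective g := by
    intro k
    induction k using QuotientAddGroup.induction_on with | _ k =>
    obtain ⟨e, ⟨heX, he⟩, -⟩ := hcode (p + k) (by rw [map_add, k.2, add_zero])
    have hψe : ψ (c e) = ψ p := by
      have := hL he
      rwa [AddMonoidHom.mem_ker, map_sub, map_add, k.2, add_zero, sub_eq_zero] at this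
    refine ⟨⟨e, heX, hψe⟩, (QuotientAddGroup.eq.2 ?_).symm⟩
    rw [AddSubgroup.mem_addSubgroupOf]
    convert he using 1
    simp only [AddSubgroup.coe_add, NegMemClass.coe_neg]
    abel
  have : (L.addSubgroupOf ψ.ker).FiniteIndex := ⟨hindex⟩
  rw [Set.encard, ENat.card_congr (Equiv.ofBijective g ⟨hinj, hsurj⟩), ENat.card_eq_coe_natCard]
  rfl

theorem index_range_eq_natAbs_det {N : Type*} [AddCommGroup N] [Module.Free ℤ N]
    [Module.Finite ℤ N] {f : N →ₗ[ℤ] N} (hf : Function.Injective f) :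
    (AddMonoidHom.range f.toAddMonoidHom).index = (LinearMap.det f).natAbs :=
  (Submodule.natAbs_det_equiv _ (LinearEquiv.ofInjective f hf)).symm

section Lattice

variable {θ : ℝ × ℝ} {q q' : Fin 2 → ℤ}

theorem linearIndependent_intCast_iff :
    LinearIndependent ℝ ![fun i => (q i : ℝ), fun i => (q' i : ℝ)] ↔
      (Matrix.of ![q, q']).det ≠ 0 := by
  have hrows : ![fun i => (q i : ℝ), fun i => (q' i : ℝ)] =
      ((Matrix.of ![q, q']).map (Int.castRingHom ℝ)).row := by
    ext i j
    fin_cases i <;> rfl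
  rw [hrows, Matrix.linearIndependent_rows_iff_isUnit, Matrix.isUnit_iff_isUnit_det,
    isUnit_iff_ne_zero, ← RingHom.mapMatrix_apply, ← RingHom.map_det]
  simp

theorem bijective_planeMap (hθ : θ.1 ≠ θ.2) (hq : (Matrix.of ![q, q']).det ≠ 0) :
    Function.Bijective (planeMap θ (fun i => (q i : ℝ)) fun i => (q' i : ℝ)) := by
  have hinj := planeMap_injective hθ (linearIndependent_intCast_iff.2 hq)
  exact ⟨hinj, (LinearMap.injective_iff_surjective_of_finrank_eq_finrank (by simp)).1 hinj⟩

theorem relIndex_unitRing {r s : ℤ} (hθ : IsQuadraticUnit r s θ)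
    (hq : (Matrix.of ![q, q']).det ≠ 0) :
    (unitRing θ).toAddSubgroup.relIndex (planeToTorus θ q q').ker =
      (Matrix.of ![q, q']).det.natAbs := by
  let φ := planeMap θ (fun i => (q i : ℝ)) fun i => (q' i : ℝ)
  obtain ⟨hφ, hsurj⟩ : Function.Bijective φ := bijective_planeMap hθ.fst_ne_snd hq
  let ι : (Fin 2 → ℤ) →+ (Fin 2 → ℝ) := (Int.castAddHom ℝ).compLeft (Fin 2)
  have hι : Function.Injective ι := Int.cast_injective.comp_left
  have hφ_apply : ∀ i j : ℤ, φ (i + j * θ) = ι (i • q + j • q') :=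
    planeMap_intCast_add_mul hθ.fst_ne_snd
  let f := Matrix.toLin' (Matrix.of ![q, q']).transpose
  have hf : Function.Injective f :=
    Matrix.mulVec_injective_of_det_ne_zero (by rwa [Matrix.det_transpose])
  have hf_apply : ∀ i j : ℤ, f ![i, j] = i • q + j • q' := fun i j => by
    rw [Matrix.toLin'_apply, Matrix.mulVec_transpose, Matrix.vecMul_eq_sum, Fin.sum_univ_two]
    rfl
  have hker : (planeToTorus θ q q').ker.map φ.toAddMonoidHom = AddSubgroup.map ι ⊤ := by
    ext x
    obtain ⟨p, rfl⟩ := hsurj x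
    exact (hφ.mem_set_image (s := (planeToTorus θ q q').ker)).trans
      (toTorusHom_eq_zero_iff.trans (by
      simp only [AddSubgroup.mem_map, AddSubgroup.mem_top, true_and]
      rfl))
  have hring : (unitRing θ).toAddSubgroup.map φ.toAddMonoidHom =
      f.toAddMonoidHom.range.map ι := by
    ext x
    simp only [AddSubgroup.mem_map, Subring.mem_toAddSubgroup, mem_unitRing_iff hθ]
    constructor
    · rintro ⟨_, ⟨i, j, rfl⟩, rfl⟩
      exact ⟨_, ⟨![i, j], rfl⟩, (congrArg ι (hf_apply i j)).trans (hφ_apply i j).symm⟩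
    · rintro ⟨_, ⟨w, rfl⟩, rfl⟩
      refine ⟨_, ⟨w 0, w 1, rfl⟩, (hφ_apply _ _).trans (congrArg ι ((hf_apply _ _).symm.trans ?_))⟩
      exact congrArg f (List.ofFn_injective rfl)
  rw [← AddSubgroup.relIndex_map_map_of_injective _ _ (f := φ.toAddMonoidHom) hφ, hker, hring,
    AddSubgroup.relIndex_map_map_of_injective _ _ hι, AddSubgroup.relIndex_top_right,
    index_range_eq_natAbs_det hf, LinearMap.det_toLin', Matrix.det_transpose]

end Lattice

/-! ### Almost every point of the torus -/

/-- The representative in `(0, 1] × (0, 1]` of a point of the torus. -/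
def torusLift (x : Torus) : Fin 2 → ℝ := fun i => AddCircle.equivIoc (1 : ℝ) 0 (x i)

theorem toTorusHom_torusLift (x : Torus) : toTorusHom (torusLift x) = x :=
  funext fun i => (AddCircle.equivIoc (1 : ℝ) 0).symm_apply_apply (x i)

theorem quasiMeasurePreserving_torusLift : Measure.QuasiMeasurePreserving torusLift := by
  have hcircle : MeasurePreserving (fun x : UnitAddCircle => (AddCircle.equivIoc (1 : ℝ) 0 x : ℝ))
      volume (volume.restrict (Set.Ioc (0 : ℝ) (0 + 1))) :=
    (measurePreserving_subtype_coe measurableSet_Ioc).comp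
      (AddCircle.measurePreserving_equivIoc (1 : ℝ) (a := 0))
  have htorus := measurePreserving_pi (fun _ : Fin 2 => (volume : Measure UnitAddCircle))
    (fun _ => volume.restrict (Set.Ioc (0 : ℝ) (0 + 1))) (fun _ => hcircle)
  rw [← Measure.restrict_pi_pi] at htorus
  exact htorus.quasiMeasurePreserving.mono_right Measure.absolutelyContinuous_restrict

theorem ae_forall_toTorusHom_eq {P : (Fin 2 → ℝ) → Prop} (hP : ∀ᵐ y, P y) :
    ∀ᵐ x : Torus, ∀ y, toTorusHom y = x → P y := by
  have htranslate : ∀ᵐ y : Fin 2 → ℝ, ∀ z : Fin 2 → ℤ, P (y + fun i => (z i : ℝ)) :=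
    ae_all_iff.2 fun z =>
      (measurePreserving_add_right volume fun i => (z i : ℝ)).quasiMeasurePreserving.ae hP
  filter_upwards [quasiMeasurePreserving_torusLift.ae htranslate] with x hx y hy
  obtain ⟨z, hz⟩ : ∃ z : Fin 2 → ℤ, (fun i => (z i : ℝ)) = y - torusLift x := by
    rw [← toTorusHom_eq_zero_iff, map_sub, hy, toTorusHom_torusLift, sub_self]
  have hPy := hx z
  rwa [hz, add_sub_cancel] at hPy

theorem quasiMeasurePreserving_linearEquiv {E F : Type*} [NormedAddCommGroup E] [NormedSpace ℝ E]
    [FiniteDimensional ℝ E] [MeasurableSpace E] [BorelSpace E] [NormedAddCommGroup F]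
    [NormedSpace ℝ F] [MeasurableSpace F] [BorelSpace F] [FiniteDimensional ℝ F]
    (μ : Measure E) [μ.IsAddHaarMeasure] (ν : Measure F) [ν.IsAddHaarMeasure] (f : E ≃ₗ[ℝ] F) :
    Measure.QuasiMeasurePreserving f μ ν := by
  have := f.isAddHaarMeasure_map μ
  exact ⟨f.toLinearMap.continuous_of_finiteDimensional.measurable,
    Measure.absolutelyContinuous_isAddHaarMeasure _ _⟩

theorem ae_isGeneric {θ : ℝ × ℝ} (hθ : (unitRing θ : Set (ℝ × ℝ)).Countable) :
    ∀ᵐ p : ℝ × ℝ, IsGeneric θ p := by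
  filter_upwards [Measure.quasiMeasurePreserving_fst.ae ((hθ.image Prod.fst).ae_notMem volume),
    Measure.quasiMeasurePreserving_snd.ae ((hθ.image Prod.snd).ae_notMem volume)] with p hfst hsnd
  exact fun v hv => ⟨fun h => hfst ⟨v, hv, h.symm⟩, fun h => hsnd ⟨v, hv, h.symm⟩⟩

theorem countable_unitRing {r s : ℤ} {θ : ℝ × ℝ} (hθ : IsQuadraticUnit r s θ) :
    (unitRing θ : Set (ℝ × ℝ)).Countable :=
  (Set.countable_range fun k : ℤ × ℤ => (k.1 + k.2 * θ : ℝ × ℝ)).mono fun v hv => by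
    obtain ⟨i, j, rfl⟩ := (mem_unitRing_iff hθ).1 hv
    exact ⟨(i, j), rfl⟩

section Fibre

variable {r s : ℤ} {θ : ℝ × ℝ} {q q' : Fin 2 → ℤ}

theorem ae_forall_planeToTorus_isGeneric (hθ : IsQuadraticUnit r s θ)
    (hq : (Matrix.of ![q, q']).det ≠ 0) :
    ∀ᵐ x : Torus, ∀ p, planeToTorus θ q q' p = x → IsGeneric θ p := by
  let φ := LinearEquiv.ofBijective _ (bijective_planeMap hθ.fst_ne_snd hq)
  filter_upwards [ae_forall_toTorusHom_eq
    ((quasiMeasurePreserving_linearEquiv volume volume φ.symm).ae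
      (ae_isGeneric (countable_unitRing hθ)))] with x hx p hp
  have := hx (φ p) hp
  rwa [φ.symm_apply_apply] at this

theorem ae_forall_planeToTorus_ne (hq : (Matrix.of ![q, q']).det = 0) :
    ∀ᵐ x : Torus, ∀ p, planeToTorus θ q q' p ≠ x := by
  let φ := planeMap θ (fun i => (q i : ℝ)) fun i => (q' i : ℝ)
  have hrange : LinearMap.range φ ≠ ⊤ := fun htop => by
    refine linearIndependent_intCast_iff.1
      (linearIndependent_of_top_le_span_of_card_eq_finrank ?_ (by simp)) hq
    rw [← htop]
    rintro _ ⟨p, rfl⟩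
    rw [Matrix.range_cons_cons_empty, Submodule.mem_span_pair]
    exact ⟨_, _, (planeMap_apply p).symm⟩
  filter_upwards [ae_forall_toTorusHom_eq
    (measure_eq_zero_iff_ae_notMem.1 (Measure.addHaar_submodule volume _ hrange))] with x hx p hp
  exact hx (φ p) hp ⟨p, rfl⟩

theorem ae_encard_codes_eq {R : Set (ℝ × ℝ)} {X : Set (ℤ → ℕ)} (hθ : IsQuadraticUnit r s θ)
    (hR : IsCodingTile θ R X) (q q' : Fin 2 → ℤ) :
    ∀ᵐ x : Torus, {e ∈ X | planeToTorus θ q q' (codePoint θ e 0) = x}.encard =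
      (Matrix.of ![q, q']).det.natAbs := by
  by_cases hq : (Matrix.of ![q, q']).det = 0
  · filter_upwards [ae_forall_planeToTorus_ne hq] with x hx
    rw [hq, Int.natAbs_zero, Nat.cast_zero, Set.encard_eq_zero]
    exact Set.eq_empty_of_forall_notMem fun e he => hx _ he.2
  · filter_upwards [ae_forall_planeToTorus_isGeneric hθ hq] with x hx
    obtain ⟨p, rfl⟩ : ∃ p, planeToTorus θ q q' p = x := by
      obtain ⟨p, hp⟩ := (bijective_planeMap hθ.fst_ne_snd hq).2 (torusLift x)
      exact ⟨p, (congrArg toTorusHom hp).trans (toTorusHom_torusLift x)⟩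
    rw [encard_setOf_eq_relIndex (L := (unitRing θ).toAddSubgroup), relIndex_unitRing hθ hq]
    · exact fun v hv => planeToTorus_eq_zero_of_mem hθ hv
    · rwa [relIndex_unitRing hθ hq, Int.natAbs_ne_zero]
    · exact fun p' hp' => hR.existsUnique_code hθ.toIsSaddle (hx p' hp')

end Fibre

/-! ### Hyperbolic matrices -/

section Matrix

variable (M : GL (Fin 2) ℤ)

theorem det_eq_one_or_neg_one : M.val.det = 1 ∨ M.val.det = -1 :=
  Int.isUnit_iff.1 ((Matrix.isUnit_iff_isUnit_det _).1 M.isUnit)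

theorem mem_spectrum_map_iff (A : Matrix (Fin 2) (Fin 2) ℤ) (z : ℂ) :
    z ∈ spectrum ℂ (A.map (Int.cast : ℤ → ℂ)) ↔ z ^ 2 - A.trace * z + A.det = 0 := by
  rw [Matrix.mem_spectrum_iff_isRoot_charpoly, Matrix.charpoly_fin_two, Polynomial.IsRoot.def]
  simp [Matrix.trace_fin_two, Matrix.det_fin_two]

variable {M}

theorem IsHyperbolic.three_le_trace (hM : IsHyperbolic M) (hr : 0 < M.val.trace)
    (hdet : M.val.det = 1) : 3 ≤ M.val.trace := by
  by_contra! hlt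
  -- Otherwise the eigenvalues are the conjugate numbers `(r ± i √(4 - r²)) / 2` of modulus one.
  have hsq : (0 : ℝ) ≤ 4 - (M.val.trace : ℝ) ^ 2 := by
    have : 0 ≤ 4 - M.val.trace ^ 2 := by nlinarith
    exact_mod_cast this
  set z : ℂ := ⟨M.val.trace / 2, √(4 - (M.val.trace : ℝ) ^ 2) / 2⟩ with hz
  have hroot := Real.mul_self_sqrt hsq
  refine hM z ((mem_spectrum_map_iff _ _).2 ?_) ?_
  · rw [hdet]
    apply Complex.ext
    · simp only [hz, pow_two, Complex.add_re, Complex.sub_re, Complex.mul_re, Complex.intCast_re,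
        Complex.intCast_im, Int.cast_one, Complex.one_re, Complex.zero_re] at hroot ⊢
      linarith
    · simp only [hz, pow_two, Complex.add_im, Complex.sub_im, Complex.mul_im, Complex.intCast_re,
        Complex.intCast_im, Int.cast_one, Complex.one_im, Complex.zero_im]
      ring
  · rw [Complex.norm_def, Complex.normSq_mk, Real.sqrt_eq_one]
    linarith

theorem IsHyperbolic.five_le_discrim (hM : IsHyperbolic M) (hr : 0 < M.val.trace) :
    5 ≤ discrim M := by
  unfold discrim
  rcases det_eq_one_or_neg_one M with hdet | hdet
  · have := hM.three_le_trace hr hdet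
    rw [hdet]
    nlinarith
  · rw [hdet]
    nlinarith

/-- The eigenvalues `(r ± √D) / 2`, the one given by `eigenvalue` being the first. -/
def eigenvaluePair (M : GL (Fin 2) ℤ) : ℝ × ℝ :=
  (eigenvalue M, (M.val.trace - √(discrim M : ℝ)) / 2)

theorem eigenvaluePair_fst_sub_snd (M : GL (Fin 2) ℤ) :
    (eigenvaluePair M).1 - (eigenvaluePair M).2 = √(discrim M : ℝ) := by
  simp only [eigenvaluePair, eigenvalue]
  ring

theorem IsHyperbolic.isQuadraticUnit (hM : IsHyperbolic M) (hr : 0 < M.val.trace) :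
    IsQuadraticUnit M.val.trace M.val.det (eigenvaluePair M) := by
  have hD : (5 : ℝ) ≤ discrim M := by exact_mod_cast hM.five_le_discrim hr
  have hroot : √(discrim M : ℝ) * √(discrim M : ℝ) = discrim M := Real.mul_self_sqrt (by linarith)
  have hroot_gt : 2 < √(discrim M : ℝ) := Real.lt_sqrt_of_sq_lt (by linarith)
  have htrace : (1 : ℝ) ≤ M.val.trace := by exact_mod_cast hr
  have hadd : (eigenvaluePair M).1 + (eigenvaluePair M).2 = M.val.trace := by
    simp only [eigenvaluePair, eigenvalue]
    ring
  have hmul : (eigenvaluePair M).1 * (eigenvaluePair M).2 = M.val.det := by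
    have hdiscrim : (discrim M : ℝ) = (M.val.trace : ℝ) ^ 2 - 4 * M.val.det := by simp [discrim]
    simp only [eigenvaluePair, eigenvalue]
    linear_combination (-1 / 4 : ℝ) * hroot - (1 / 4 : ℝ) * hdiscrim
  have hfst : 1 < (eigenvaluePair M).1 := by
    simp only [eigenvaluePair, eigenvalue]
    linarith
  have habs : |(eigenvaluePair M).1| * |(eigenvaluePair M).2| = 1 := by
    rw [← abs_mul, hmul]
    rcases det_eq_one_or_neg_one M with h | h <;> simp [h]
  rw [abs_of_pos (one_pos.trans hfst)] at habs
  exact {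
    one_lt_fst := hfst
    abs_snd_lt_one := by nlinarith [abs_nonneg (eigenvaluePair M).2]
    snd_ne_zero := fun h => by simp [h] at habs
    sq_norm := by rcases det_eq_one_or_neg_one M with h | h <;> simp [h]
    add_eq := hadd
    mul_eq := hmul }

theorem IsHyperbolic.exists_isCodingTile (hM : IsHyperbolic M) (hr : 0 < M.val.trace) :
    ∃ R, IsCodingTile (eigenvaluePair M) R (compactum M) := by
  have hθ := hM.isQuadraticUnit hr
  rcases det_eq_one_or_neg_one M with hdet | hdet
  · have hX : compactum M = soficCompactum M.val.trace := by simp [compactum, hdet]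
    rw [hX]
    exact ⟨_, (hdet ▸ hθ).isCodingTile_sofic⟩
  · have hX : compactum M = markovCompactum M.val.trace := by simp [compactum, hdet]
    rw [hX]
    exact ⟨_, (hdet ▸ hθ).isCodingTile_markov⟩

theorem mulVec_latticeVector (M : GL (Fin 2) ℤ) (u v : ℤ) :
    M.val.mulVec (latticeVector M u v) = M.val.trace • latticeVector M u v + ![v, u] := by
  have hdet : M.val.det * M.val.det = 1 := by
    rcases det_eq_one_or_neg_one M with h | h <;> simp [h]
  rw [latticeVector, Matrix.mulVec_smul, mulVec_mulVec_eq, smul_sub, smul_comm,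
    smul_smul _ _ ![v, u], neg_mul, hdet, neg_one_smul, sub_neg_eq_add]

theorem homoclinicPoint_eq_planeToTorus (hM : IsHyperbolic M) (hr : 0 < M.val.trace) (u v : ℤ) :
    homoclinicPoint M u v = planeToTorus (eigenvaluePair M) (latticeVector M u v)
      (M.val.mulVec (latticeVector M u v)) (1, 0) := by
  refine congrArg toTorusHom (funext fun i => ?_)
  change _ = (planeMap _ _ _ _ : Fin 2 → ℝ) i
  rw [planeMap_apply, mulVec_latticeVector, eigenvaluePair_fst_sub_snd]
  simp only [Pi.add_apply, Pi.smul_apply, smul_eq_mul, Int.cast_add, Int.cast_mul,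
    ← (hM.isQuadraticUnit hr).add_eq]
  fin_cases i
  all_goals
    simp only [Fin.isValue, Nat.succ_eq_add_one, Nat.reduceAdd, Fin.zero_eta, Fin.mk_one,
      Matrix.cons_val_zero, Matrix.cons_val_one, Matrix.cons_val_fin_one, eigenvaluePair, mul_zero,
      mul_one, zero_sub, mul_neg, neg_mul, sub_zero]
    ring

theorem natAbs_assocForm (M : GL (Fin 2) ℤ) (u v : ℤ) :
    (assocForm M u (-v)).natAbs =
      (Matrix.of ![latticeVector M u v, M.val.mulVec (latticeVector M u v)]).det.natAbs := by
  have hdet : (Matrix.of ![latticeVector M u v, M.val.mulVec (latticeVector M u v)]).det =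
      -(M.val.det * assocForm M u (-v)) := by
    have hq : ∀ i, latticeVector M u v i = -M.val.det * (M.val i 0 * v + M.val i 1 * u) :=
      fun i => by simp only [latticeVector, Pi.smul_apply, Matrix.mulVec, dotProduct,
        Fin.sum_univ_two, Matrix.cons_val_zero, Matrix.cons_val_one, smul_eq_mul]
    rw [Matrix.det_fin_two, mulVec_latticeVector]
    simp only [Matrix.of_apply, Matrix.cons_val_zero, Matrix.cons_val_one, Pi.add_apply,
      Pi.smul_apply, smul_eq_mul, hq, assocForm]
    ring
  rw [hdet, Int.natAbs_neg, Int.natAbs_mul]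
  rcases det_eq_one_or_neg_one M with h | h <;> simp [h]

end Matrix

end ToralCoding

end

theorem theorem3p1 (M : GL (Fin 2) ℤ) (hM : ToralCoding.IsHyperbolic M)
    (hr : 0 < M.val.trace) (u v : ℤ) :
    ToralCoding.IsHomoclinic M (ToralCoding.homoclinicPoint M u v) ∧
    (∀ e ∈ ToralCoding.compactum M,
      Tendsto (ToralCoding.partialSum M (ToralCoding.homoclinicPoint M u v) e) atTop
        (𝓝 (ToralCoding.coding M (ToralCoding.homoclinicPoint M u v) e))) ∧
    ∀ᵐ x : ToralCoding.Torus,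
      {e ∈ ToralCoding.compactum M |
        ToralCoding.coding M (ToralCoding.homoclinicPoint M u v) e = x}.encard
          = ((ToralCoding.assocForm M u (-v)).natAbs : ℕ∞) := by
  have hθ := hM.isQuadraticUnit hr
  obtain ⟨R, hR⟩ := hM.exists_isCodingTile hr
  obtain ⟨B, hB⟩ := hR.exists_digit_le
  rw [ToralCoding.homoclinicPoint_eq_planeToTorus hM hr, ToralCoding.natAbs_assocForm]
  set q := ToralCoding.latticeVector M u v
  have hlim (e) (he : e ∈ ToralCoding.compactum M) :=
    ToralCoding.tendsto_partialSum (q := q) hθ (hB e he)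
  have hcoding (e) (he : e ∈ ToralCoding.compactum M) := (hlim e he).limUnder_eq
  refine ⟨ToralCoding.isHomoclinic_planeToTorus hθ,
    fun e he => tendsto_nhds_limUnder ⟨_, hlim e he⟩, ?_⟩
  filter_upwards [ToralCoding.ae_encard_codes_eq hθ hR q (M.val.mulVec q)] with x hx
  rw [← hx]
  congr 1
  ext e
  exact and_congr_right fun he => by rw [← hcoding e he, ToralCoding.coding]
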